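/- **Theorem 2.** For $L\ge 0$ let $\mathcal P([0,1];L)$ be the set of probability distributions on $[0,1]$ that have a density $f$ with $|f(x)-f(y)|\le L|x-y|$ for all $x,y\in[0,1]$; let $u$ be the uniform distribution on $[0,1]$ and $\|p-u\|_1=\int_0^1|f(x)-1|\,dx$ for $p\in\mathcal P([0,1];L)$ with density $f$. The *Adaptive Binning Coincidence (ABC) test* with parameters $\varepsilon>0$, $\delta\in(0,1)$ and $c_0$ is the following. For $n$ samples and $m\ge1$ let $K_1(n;m)$ be the number of bins that contain exactly one of the samples, when $[0,1]$ is divided uniformly into $m$ bins, and let $c_u(n;m)$ be the expectation of $K_1(n;m)$ when the $n$ samples are i.i.d. from $u$. For $k\ge1$ put $$m_k=\lceil c_0k^4\log(k+2/\delta)\rceil,\quad n_k=\lceil\sqrt{c_0}\,k^3\log(k+2/\delta)\rceil,\quad \tau_k=9n_k\sqrt{\frac{\log(k+2/\delta)}{m_k}} .$$ In the epochs $k=1,2,\dots$ with $k\le 576\,\varepsilon^{-2}$, one after the other, the test continues sampling until it has $n_k$ samples in total; if $c_u(n_k;m_k)-K_1(n_k;m_k)>\tau_k$, where $K_1(n_k;m_k)$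 is computed from all $n_k$ samples, it stops and outputs $H_1$. If all epochs are completed without such an exit, it outputs $H_0$. Let $\Gamma$ be the number of samples taken. There is a universal constant $C>0$ such that the following holds for all $L\ge0$, $\varepsilon>0$, $\delta\in(0,1)$ and $c_0\ge\max\{28212,2L\}$. * (Alternative.) If the samples are i.i.d. from $p\in\mathcal P([0,1];L)$ with $\|p-u\|_1=\gamma\ge\varepsilon$, then the expected sample complexity satisfies $$\mathbb E[\Gamma]\le C\sqrt{c_0}\;\frac1{\gamma^6}\log\Big(\frac1\gamma+\frac1\delta\Big),$$ and the test outputs $H_1$ with probability at least $1-\delta$. * (Null.) If the samples are i.i.d. from $u$, then $$\mathbb E[\Gamma]\le C\sqrt{c_0}\;\frac1{\varepsilon^6}\log\Big(\frac1\varepsilon+\frac1\delta\Big),$$ and the test outputs $H_0$ with probability at least $1-\delta$. -/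

import Mathlib

open MeasureTheory ProbabilityTheory
open scoped NNReal ENNReal unitInterval

noncomputable section

namespace ABC

/-! ### Distributions on the unit interval -/

/-- The probability measure `P` is a distribution on `[0,1]`, absolutely continuous with respect to Lebesgue measure, with
nonnegative `L`-Lipschitz density `f`. (`volume` on `I = [0,1]` is Lebesgue measure, that is, the
uniform distribution. That `f` integrates to one follows from `P` being a probability measure.) -/
structure HasLipschitzDensity (L : ℝ≥0) (P : Measure I) [IsProbabilityMeasure P] (f : I → ℝ) :
    Prop where
  nonneg : ∀ x, 0 ≤ f x
  lipschitz : LipschitzWith L f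
  eq_withDensity : P = (volume : Measure I).withDensity fun x => ENNReal.ofReal (f x)

/-- The `ℓ₁` distance `∫₀¹ |f(x) - 1| dx` between the distribution with density `f` and the
uniform distribution. -/
def l1DistUniform (f : I → ℝ) : ℝ := ∫ x : I, |f x - 1|

/-- The law of an infinite sequence of i.i.d. samples from `P`. -/
def sampleLaw (P : Measure I) [IsProbabilityMeasure P] : Measure (ℕ → I) :=
  Measure.infinitePi fun _ : ℕ => P

/-! ### The coincidence statistic -/

/-- The coincidence number `K₁` of `n` labels: the number of labels in `{0, …, m - 1}` that appear
exactly once. -/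
def coincidence (m : ℕ) {n : ℕ} (s : Fin n → ℕ) : ℕ :=
  ((Finset.range m).filter fun j =>
    (Finset.univ.filter fun i : Fin n => s i = j).card = 1).card

/-- `c_u(n; m)`: the expected coincidence number of `n` independent samples from the uniform
distribution on `m` labels, that is, the average of `K₁` over all `m ^ n` label sequences. -/
def expectedCoincidence (n m : ℕ) : ℝ :=
  (∑ s : Fin n → Fin m, (coincidence m (fun i => (s i : ℕ)) : ℝ)) / (m : ℝ) ^ n

/-- The label in `{0, …, m - 1}` of the bin that contains `x`, when `[0,1]` is divided uniformly
into `m` bins `[j/m, (j+1)/m)`, the last one closed. -/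
def binLabel (m : ℕ) (x : I) : ℕ := min ⌊(m : ℝ) * (x : ℝ)⌋₊ (m - 1)

/-- `K₁(S; m)`, where `S` consists of the first `n` samples of `x`. -/
def binnedCoincidence (n m : ℕ) (x : ℕ → I) : ℕ :=
  coincidence m fun i : Fin n => binLabel m (x i)

/-! ### The Adaptive Binning Coincidence test -/

/-- The two hypotheses, as possible outputs of the test. -/
inductive Hypothesis : Type
  | H0 : Hypothesis
  | H1 : Hypothesis

/-- The number `m_k` of bins in epoch `k`. -/
def numBins (c₀ δ : ℝ) (k : ℕ) : ℕ :=
  ⌈c₀ * (k : ℝ) ^ 4 * Real.log ((k : ℝ) + 2 / δ)⌉₊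

/-- The total number `n_k` of samples collected by the end of epoch `k` (so `n_0 = 0`). -/
def numSamples (c₀ δ : ℝ) (k : ℕ) : ℕ :=
  ⌈Real.sqrt c₀ * (k : ℝ) ^ 3 * Real.log ((k : ℝ) + 2 / δ)⌉₊

/-- The threshold `τ_k` of epoch `k`. -/
def threshold (c₀ δ : ℝ) (k : ℕ) : ℝ :=
  9 * (numSamples c₀ δ k : ℝ) *
    Real.sqrt (Real.log ((k : ℝ) + 2 / δ) / (numBins c₀ δ k : ℝ))

/-- The exit condition `Z_k = c_u(n_k; m_k) - K₁(S; m_k) > τ_k` at the end of epoch `k`. -/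
def Exits (c₀ δ : ℝ) (x : ℕ → I) (k : ℕ) : Prop :=
  threshold c₀ δ k <
    expectedCoincidence (numSamples c₀ δ k) (numBins c₀ δ k) -
      (binnedCoincidence (numSamples c₀ δ k) (numBins c₀ δ k) x : ℝ)

/-- The number of the last epoch: the epochs are the `k ≥ 1` with `k ≤ κ = 576 ε⁻²`. -/
def lastEpoch (ε : ℝ) : ℕ := ⌊576 / ε ^ 2⌋₊

/-- In some epoch `1 ≤ k ≤ κ` the exit condition holds. -/
def ExitsSomewhere (c₀ ε δ : ℝ) (x : ℕ → I) : Prop :=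
  ∃ k, 1 ≤ k ∧ k ≤ lastEpoch ε ∧ Exits c₀ δ x k

open Classical in
/-- The epoch in which the test terminates on the samples `x`: the first epoch in which the exit
condition holds, and the last epoch if there is none (zero if there are no epochs at all). -/
def stoppingEpoch (c₀ ε δ : ℝ) (x : ℕ → I) : ℕ :=
  if h : ExitsSomewhere c₀ ε δ x then Nat.find h else lastEpoch ε

open Classical in
/-- The output of the test: `H1` if it exits in some epoch, and `H0` if all epochs are completed
without an exit. -/
def output (c₀ ε δ : ℝ) (x : ℕ → I) : Hypothesis :=
  if ExitsSomewhere c₀ ε δ x then Hypothesis.H1 else Hypothesis.H0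

/-- The number of samples that the test takes before it terminates. -/
def samplesUsed (c₀ ε δ : ℝ) (x : ℕ → I) : ℕ :=
  numSamples c₀ δ (stoppingEpoch c₀ ε δ x)

/-- The expected sample complexity of the test on i.i.d. samples from `P`. -/
def expectedSamples (c₀ ε δ : ℝ) (P : Measure I) [IsProbabilityMeasure P] : ℝ≥0∞ :=
  ∫⁻ x, (samplesUsed c₀ ε δ x : ℝ≥0∞) ∂(sampleLaw P)

/-- The probability that the test outputs `H` on i.i.d. samples from `P`. -/
def outputProb (c₀ ε δ : ℝ) (P : Measure I) [IsProbabilityMeasure P] (H : Hypothesis) : ℝ :=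
  (sampleLaw P).real {x | output c₀ ε δ x = H}

end ABC

end

namespace ABC


/-! Since `K₁ = n - collisions`, where `collisions` counts the samples that share their bin with
another one, epoch `k` exits exactly when `collisions` exceeds its uniform mean `n - c_u` by more
than `τ_k`. Write `l = log (k + 2/δ)` and `μ = n(n-1)/m`. The parameters give `μ ≈ k² l` and `τ_k ≈
9 k l` (`sample_bin_estimates`), and `n - c_u` is `μ` up to a small fraction of `τ_k`. Both error
probabilities are Chernoff bounds.

Under the null, a draw raises `collisions` by at most 2, and only if it hits an occupied bin; this
bounds the exponential moment (`drawStep_iterate_exp_collisions_le`). A false alarm in epoch `k`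
then has probability at most `(k + 2/δ)⁻²`, and these bounds sum to at most `δ/2`.

Under the alternative, the Laplace transform of `collisions` is a mean of a product over the bins.
Negative association (`drawStep_iterate_prod_le`) decouples the bins into binomials, and a cubic
majorant makes each factor explicit (`drawStep_iterate_exp_neg_collisions_le`). The relevant mean is
`n(n-1) ∑ p_j²`, and Cauchy-Schwarz with the Lipschitz bound gives `∑ p_j² ≥ (1 + γ²/4)/m`
(`HasLipschitzDensity.le_sum_binProb_sq`). Once `k` is about `576/γ²`, the excess `μγ²/4` is far
above `τ_k`, and a miss has probability at most `(k + 2/δ)⁻⁶`.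

This sixth power outweighs the growth of `n_{k+1}`, so the epochs after the one numbered about
`576/γ²` add at most `√c₀` to the expected sample size. -/

/-! ### ### Occupancy numbers of independent labels -/

/-- The number of times that each label occurs in a finite sequence. -/
def occupancy {ι : Type*} [DecidableEq ι] {n : ℕ} (s : Fin n → ι) : ι → ℕ :=
  fun j => (Finset.univ.filter fun i => s i = j).card

/-- The expectation of `F` after one more label, of distribution `p`, has been drawn, as a function
of the occupancy numbers before the draw. -/
def drawStep {ι : Type*} [Fintype ι] [DecidableEq ι] (p : ι → ℝ) (F : (ι → ℕ) → ℝ) : (ι → ℕ) → ℝ :=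
  fun N => ∑ j, p j * F (N + Pi.single j 1)

lemma occupancy_cons {ι : Type*} [DecidableEq ι] {n : ℕ} (j : ι) (s : Fin n → ι) :
    occupancy (Fin.cons j s : Fin (n + 1) → ι) = Pi.single j 1 + occupancy s := by
  funext i
  simp only [occupancy, Finset.card_filter, Fin.sum_univ_succ, Fin.cons_zero, Fin.cons_succ,
    Pi.add_apply, Pi.single_apply, eq_comm]

lemma sum_occupancy {ι : Type*} [Fintype ι] [DecidableEq ι]
    {n : ℕ} (s : Fin n → ι) : ∑ j, occupancy s j = n := by
  simp only [occupancy]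
  rw [← Finset.card_eq_sum_card_fiberwise (fun _ _ => Finset.mem_coe.2 (Finset.mem_univ _))]
  simp

/-- The expectation of a function of the occupancy numbers of `n` independent labels. -/
lemma sum_prod_mul_occupancy {ι : Type*} [Fintype ι] [DecidableEq ι]
    (p : ι → ℝ) (F : (ι → ℕ) → ℝ) (n : ℕ) (N : ι → ℕ) :
    ∑ s : Fin n → ι, (∏ i, p (s i)) * F (N + occupancy s) = (drawStep p)^[n] F N := by
  induction n generalizing N with
  | zero =>
    have h : ∀ s : Fin 0 → ι, occupancy s = 0 := fun s => by funext j; simp [occupancy]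
    simp [h]
  | succ n ih =>
    rw [Function.iterate_succ_apply']
    simp only [drawStep]
    rw [← (Fin.consEquiv fun _ : Fin (n + 1) => ι).sum_comp, Fintype.sum_prod_type]
    refine Finset.sum_congr rfl fun j _ => ?_
    rw [← ih, Finset.mul_sum]
    refine Finset.sum_congr rfl fun s _ => ?_
    rw [show Fin.consEquiv (fun _ => ι) (j, s) = Fin.cons j s from rfl, occupancy_cons]
    simp only [Fin.prod_univ_succ, Fin.cons_zero, Fin.cons_succ]
    rw [add_assoc, mul_assoc]

lemma drawStep_mono {ι : Type*} [Fintype ι] [DecidableEq ι]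
    {p : ι → ℝ} (hp : ∀ j, 0 ≤ p j) {F G : (ι → ℕ) → ℝ} (h : ∀ N, F N ≤ G N)
    (N : ι → ℕ) : drawStep p F N ≤ drawStep p G N :=
  Finset.sum_le_sum fun j _ => mul_le_mul_of_nonneg_left (h _) (hp j)

lemma drawStep_iterate_mono {ι : Type*} [Fintype ι] [DecidableEq ι]
    {p : ι → ℝ} (hp : ∀ j, 0 ≤ p j) {F G : (ι → ℕ) → ℝ}
    (h : ∀ N, F N ≤ G N) (n : ℕ) (N : ι → ℕ) :
    (drawStep p)^[n] F N ≤ (drawStep p)^[n] G N := by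
  induction n generalizing N with
  | zero => exact h N
  | succ n ih =>
    rw [Function.iterate_succ_apply', Function.iterate_succ_apply']
    exact drawStep_mono hp ih N

/-! ### The number of colliding samples -/

/-- The number of samples that share their label with another sample. -/
def collisions {ι : Type*} [Fintype ι] (N : ι → ℕ) : ℝ := ∑ j, if 2 ≤ N j then (N j : ℝ) else 0

lemma sum_eq_collisions_add {ι : Type*} [Fintype ι] (N : ι → ℕ) :
    ∑ j, (N j : ℝ) = collisions N + ((Finset.univ.filter fun j => N j = 1).card : ℝ) := by
  rw [collisions, Finset.card_filter, Nat.cast_sum, ← Finset.sum_add_distrib]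
  refine Finset.sum_congr rfl fun j _ => ?_
  rcases lt_trichotomy (N j) 1 with h | h | h
  · have : N j = 0 := by omega
    simp [this]
  · simp [h]
  · simp [show 2 ≤ N j from h, show N j ≠ 1 by omega]

/-- In an occupied bin the new sample collides, and so does its single occupant if that was alone
before: hence the 2. -/
lemma collisions_add_single_le {ι : Type*} [Fintype ι] [DecidableEq ι] (N : ι → ℕ) (j : ι) :
    collisions (N + Pi.single j 1) ≤ collisions N + if 1 ≤ N j then 2 else 0 := by
  have h : ∀ i, (if 2 ≤ (N + Pi.single j 1 : ι → ℕ) i then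
      (((N + Pi.single j 1 : ι → ℕ) i : ℕ) : ℝ) else 0)
      ≤ (if 2 ≤ N i then (N i : ℝ) else 0) + if i = j then (if 1 ≤ N i then 2 else 0) else 0 := by
    intro i
    by_cases hij : i = j
    · subst hij
      simp only [Pi.add_apply, Pi.single_eq_same, if_true]
      rcases lt_trichotomy (N i) 1 with h | h | h
      · have : N i = 0 := by omega
        simp [this]
      · norm_num [h]
      · rw [if_pos (by omega), if_pos (by omega), if_pos (by omega)]
        push_cast
        linarith
    · simp [hij]
  calc collisions (N + Pi.single j 1) ≤ _ := Finset.sum_le_sum fun i _ => h i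
    _ = _ := by rw [Finset.sum_add_distrib, collisions]; simp

/-- The moment generating function of the number of collisions of uniform labels is at most that of
twice a Poisson variable. -/
lemma drawStep_iterate_exp_collisions_le {ι : Type*} [Fintype ι] [DecidableEq ι]
    {p : ι → ℝ} {r t : ℝ} (hp : ∀ j, p j = r) (hr : 0 ≤ r)
    (hp1 : ∑ j, p j = 1) (ht : 0 ≤ t) (n : ℕ) (N : ι → ℕ) :
    (drawStep p)^[n] (fun N => Real.exp (t * collisions N)) N ≤
      Real.exp (t * collisions N +
        r * (Real.exp (2 * t) - 1) * (n * ∑ j, (N j : ℝ) + n * (n - 1) / 2)) := by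
  have he : 0 ≤ Real.exp (2 * t) - 1 := by
    linarith [Real.add_one_le_exp (2 * t)]
  induction n generalizing N with
  | zero => simp
  | succ n ih =>
    rw [Function.iterate_succ_apply']
    refine (drawStep_mono (fun j => (hp j).symm ▸ hr) ih N).trans ?_
    set e := Real.exp (2 * t) - 1 with hedef
    set T := ∑ j, (N j : ℝ) with hT
    have hsum : ∀ j, ∑ i, (((N + Pi.single j 1 : ι → ℕ) i : ℕ) : ℝ) = T + 1 := by
      intro j
      simp only [Pi.add_apply, Nat.cast_add, Finset.sum_add_distrib, hT]
      congr 1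
      rw [← Nat.cast_sum]
      simp
    -- The indicator of an occupied bin is bounded by `N j`, so that the sum over `j` only involves
    -- the total count `T`.
    have hstep : ∀ j, Real.exp (t * collisions (N + Pi.single j 1)) ≤
        Real.exp (t * collisions N) * (1 + e * N j) := by
      intro j
      calc Real.exp (t * collisions (N + Pi.single j 1))
          ≤ Real.exp (t * (collisions N + if 1 ≤ N j then 2 else 0)) :=
            Real.exp_le_exp.2 (mul_le_mul_of_nonneg_left (collisions_add_single_le N j) ht)
        _ = Real.exp (t * collisions N) * Real.exp (t * if 1 ≤ N j then 2 else 0) := by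
            rw [mul_add, Real.exp_add]
        _ ≤ _ := by
            refine mul_le_mul_of_nonneg_left ?_ (Real.exp_pos _).le
            split_ifs with h
            · have : (1 : ℝ) ≤ N j := by exact_mod_cast h
              rw [mul_comm t 2]
              nlinarith
            · simp only [mul_zero, Real.exp_zero]
              nlinarith [(Nat.cast_nonneg (N j) : (0 : ℝ) ≤ N j)]
    simp only [drawStep, hsum]
    set c := r * e * (n * (T + 1) + n * (n - 1) / 2) with hc
    calc ∑ j, p j * Real.exp (t * collisions (N + Pi.single j 1) + c)
        ≤ ∑ j, Real.exp (t * collisions N) * Real.exp c * (p j + r * e * N j) := by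
          refine Finset.sum_le_sum fun j _ => ?_
          rw [Real.exp_add, ← mul_assoc, hp]
          calc _ ≤ r * (Real.exp (t * collisions N) * (1 + e * N j)) * Real.exp c := by
                gcongr
                exact hstep j
            _ = _ := by ring
      _ = Real.exp (t * collisions N) * Real.exp c * (1 + r * e * T) := by
          rw [← Finset.mul_sum, Finset.sum_add_distrib, hp1, ← Finset.mul_sum]
      _ ≤ Real.exp (t * collisions N) * Real.exp c * Real.exp (r * e * T) := by
          gcongr
          linarith [Real.add_one_le_exp (r * e * T)]
      _ = _ := by
          rw [← Real.exp_add, ← Real.exp_add, hc]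
          congr 1
          push_cast
          ring

/-! ### A product inequality for the occupancy numbers -/

/-- The expectation of `g (r + b)`, where `b` is a Bernoulli variable of parameter `q`. -/
def bernoulliStep (q : ℝ) (g : ℕ → ℝ) : ℕ → ℝ := fun r => (1 - q) * g r + q * g (r + 1)

lemma bernoulliStep_mono {q : ℝ} (h0 : 0 ≤ q) (h1 : q ≤ 1) {g h : ℕ → ℝ} (hgh : ∀ r, g r ≤ h r)
    (r : ℕ) : bernoulliStep q g r ≤ bernoulliStep q h r :=
  add_le_add (mul_le_mul_of_nonneg_left (hgh _) (by linarith))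
    (mul_le_mul_of_nonneg_left (hgh _) h0)

lemma bernoulliStep_iterate_mono {q : ℝ} (h0 : 0 ≤ q) (h1 : q ≤ 1) {g h : ℕ → ℝ}
    (hgh : ∀ r, g r ≤ h r) (n r : ℕ) :
    (bernoulliStep q)^[n] g r ≤ (bernoulliStep q)^[n] h r := by
  induction n generalizing r with
  | zero => exact hgh r
  | succ n ih =>
    rw [Function.iterate_succ_apply', Function.iterate_succ_apply']
    exact bernoulliStep_mono h0 h1 ih r

lemma bernoulliStep_pos {q : ℝ} (h0 : 0 ≤ q) (h1 : q ≤ 1) {g : ℕ → ℝ} (hg : ∀ r, 0 < g r) (r : ℕ) :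
    0 < bernoulliStep q g r := by
  rcases h0.eq_or_lt with h | h
  · simp [bernoulliStep, ← h, hg]
  · exact add_pos_of_nonneg_of_pos (mul_nonneg (by linarith) (hg _).le) (mul_pos h (hg _))

lemma bernoulliStep_antitone {q : ℝ} (h0 : 0 ≤ q) (h1 : q ≤ 1) {g : ℕ → ℝ} (hg : Antitone g) :
    Antitone (bernoulliStep q g) := fun _ _ h =>
  add_le_add (mul_le_mul_of_nonneg_left (hg h) (by linarith))
    (mul_le_mul_of_nonneg_left (hg (Nat.succ_le_succ h)) h0)

lemma one_sub_sum_le_prod_one_sub {ι : Type*} (s : Finset ι) {x : ι → ℝ} (h0 : ∀ i, 0 ≤ x i)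
    (h1 : ∀ i, x i ≤ 1) : 1 - ∑ i ∈ s, x i ≤ ∏ i ∈ s, (1 - x i) := by
  classical
  induction s using Finset.induction_on with
  | empty => simp
  | insert a s ha ih =>
    rw [Finset.sum_insert ha, Finset.prod_insert ha]
    have h2 : ∏ i ∈ s, (1 - x i) ≤ 1 :=
      Finset.prod_le_one (fun i _ => by linarith [h1 i]) (fun i _ => by linarith [h0 i])
    nlinarith [h0 a]

/-- Drawing `j` multiplies the product by `g j (N j + 1) / g j (N j)`, so the mean is the product
times `1 - ∑ x j`, where `x j` is the expected relative loss in bin `j`. Replacing `1 - ∑ x j` by `∏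
(1 - x j)` gives each bin its own independent Bernoulli draw. Positivity and antitonicity put `x j`
in `[0, 1]`. -/
lemma drawStep_prod_le {ι : Type*} [Fintype ι] [DecidableEq ι]
    {p : ι → ℝ} (hp : ∀ j, 0 ≤ p j) (hp1 : ∑ j, p j = 1) {g : ι → ℕ → ℝ}
    (hg : ∀ j r, 0 < g j r) (hanti : ∀ j, Antitone (g j)) (N : ι → ℕ) :
    drawStep p (fun N => ∏ j, g j (N j)) N ≤ ∏ j, bernoulliStep (p j) (g j) (N j) := by
  have hle : ∀ j, p j ≤ 1 := fun j =>
    hp1 ▸ Finset.single_le_sum (fun i _ => hp i) (Finset.mem_univ j)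
  set x : ι → ℝ := fun j => p j * (1 - g j (N j + 1) / g j (N j)) with hx
  have hq0 : ∀ j, 0 ≤ 1 - g j (N j + 1) / g j (N j) := fun j => by
    rw [sub_nonneg, div_le_one (hg _ _)]
    exact hanti j (Nat.le_succ _)
  have hq1 : ∀ j, 1 - g j (N j + 1) / g j (N j) ≤ 1 := fun j => by
    linarith [div_pos (hg j (N j + 1)) (hg j (N j))]
  have hA : 0 ≤ ∏ j, g j (N j) := Finset.prod_nonneg fun j _ => (hg _ _).le
  calc drawStep p (fun N => ∏ j, g j (N j)) N
      = ∑ j, (∏ i, g i (N i)) * (p j - x j) := by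
        refine Finset.sum_congr rfl fun j _ => ?_
        beta_reduce
        rw [← Finset.mul_prod_erase _ _ (Finset.mem_univ j),
          ← Finset.mul_prod_erase _ (fun i => g i (N i)) (Finset.mem_univ j)]
        have : ∏ i ∈ Finset.univ.erase j, g i ((N + Pi.single j 1 : ι → ℕ) i) =
            ∏ i ∈ Finset.univ.erase j, g i (N i) := by
          refine Finset.prod_congr rfl fun i hi => ?_
          simp [(Finset.mem_erase.1 hi).1]
        rw [this]
        simp only [Pi.add_apply, Pi.single_eq_same, hx]
        have := (hg j (N j)).ne'
        field_simp
        ring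
    _ = (∏ i, g i (N i)) * (1 - ∑ j, x j) := by
        rw [← Finset.mul_sum, Finset.sum_sub_distrib, hp1]
    _ ≤ (∏ i, g i (N i)) * ∏ j, (1 - x j) := by
        refine mul_le_mul_of_nonneg_left (one_sub_sum_le_prod_one_sub _ ?_ ?_) hA
        · exact fun j => mul_nonneg (hp j) (hq0 j)
        · exact fun j => mul_le_one₀ (hle j) (hq0 j) (hq1 j)
    _ = ∏ j, bernoulliStep (p j) (g j) (N j) := by
        rw [← Finset.prod_mul_distrib]
        refine Finset.prod_congr rfl fun j _ => ?_
        have := (hg j (N j)).ne'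
        simp only [hx, bernoulliStep]
        field_simp
        ring

/-- Negative association of the occupancy numbers, for products of decreasing functions. -/
lemma drawStep_iterate_prod_le {ι : Type*} [Fintype ι] [DecidableEq ι]
    {p : ι → ℝ} (hp : ∀ j, 0 ≤ p j) (hp1 : ∑ j, p j = 1)
    {g : ι → ℕ → ℝ} (hg : ∀ j r, 0 < g j r) (hanti : ∀ j, Antitone (g j)) (n : ℕ) (N : ι → ℕ) :
    (drawStep p)^[n] (fun N => ∏ j, g j (N j)) N ≤
      ∏ j, (bernoulliStep (p j))^[n] (g j) (N j) := by
  have hle : ∀ j, p j ≤ 1 := fun j =>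
    hp1 ▸ Finset.single_le_sum (fun i _ => hp i) (Finset.mem_univ j)
  induction n generalizing g with
  | zero => exact le_rfl
  | succ n ih =>
    -- The last draw is peeled off: its bound is again a product of positive antitone functions, so
    -- the induction hypothesis applies to the new `g`.
    simp only [Function.iterate_succ_apply]
    exact (drawStep_iterate_mono hp (drawStep_prod_le hp hp1 hg hanti) n N).trans
      (ih (fun j => bernoulliStep_pos (hp j) (hle j) (hg j))
        (fun j => bernoulliStep_antitone (hp j) (hle j) (hanti j)))

/-- The expectation of a cubic polynomial of a binomial variable. -/
lemma bernoulliStep_iterate_cubic (q a b : ℝ) (n r : ℕ) :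
    (bernoulliStep q)^[n] (fun r => 1 + a * (r * (r - 1)) + b * (r * (r - 1) * (r - 2))) r =
      1 + a * (r * (r - 1) + 2 * n * r * q + n * (n - 1) * q ^ 2) +
        b * (r * (r - 1) * (r - 2) + 3 * n * (r * (r - 1)) * q + 3 * (n * (n - 1)) * r * q ^ 2 +
          n * (n - 1) * (n - 2) * q ^ 3) := by
  induction n generalizing r with
  | zero => simp
  | succ n ih =>
    rw [Function.iterate_succ_apply', bernoulliStep, ih, ih]
    push_cast
    ring

/-- A cubic polynomial that dominates `exp (-t r)`, for `r ≥ 2`, and `1`, for `r ≤ 1`. -/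
lemma exp_neg_ite_le {t : ℝ} (ht : 0 ≤ t) (r : ℕ) :
    Real.exp (-(t * if 2 ≤ r then (r : ℝ) else 0)) ≤
      1 + (-t + t ^ 2) * (r * (r - 1)) + t / 2 * (r * (r - 1) * (r - 2)) := by
  split_ifs with h
  · have hr : (2 : ℝ) ≤ r := by exact_mod_cast h
    have hx : 0 ≤ t * r := by positivity
    -- With `x = t r`, this is `(1 - x + x²/2)(1 + x + x²/2) = 1 + x⁴/4 ≥ 1`.
    have h1 : Real.exp (-(t * r)) ≤ 1 - t * r + (t * r) ^ 2 / 2 := by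
      rw [Real.exp_neg, inv_le_comm₀ (Real.exp_pos _) (by nlinarith [sq_nonneg (t * r - 1)])]
      refine le_trans ?_ (Real.quadratic_le_exp_of_nonneg hx)
      rw [inv_le_iff_one_le_mul₀ (by nlinarith [sq_nonneg (t * r - 1)])]
      nlinarith [sq_nonneg ((t * r) ^ 2)]
    have h2 : (r : ℝ) ^ 2 ≤ 2 * (r * (r - 1)) := by nlinarith
    -- Here integrality of `r` matters. The cubic coefficient `t/2` is chosen so that the terms
    -- linear in `t` differ by exactly `t/2` times this product.
    have h3 : 0 ≤ (r : ℝ) * (r - 2) * (r - 3) := by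
      rcases h.eq_or_lt with h | h
      · simp [← h]
      · have : (3 : ℝ) ≤ r := by exact_mod_cast h
        exact mul_nonneg (mul_nonneg (by linarith) (by linarith)) (by linarith)
    have h5 : (r : ℝ) * (r - 2) * (r - 3) = r * (r - 1) * (r - 2) - 2 * (r * (r - 1)) + 2 * r := by
      ring
    nlinarith [mul_le_mul_of_nonneg_left h2 (sq_nonneg t), mul_nonneg ht h3]
  · interval_cases r <;> simp

/-- The lower tail of the number of collisions, through its Laplace transform. -/
lemma drawStep_iterate_exp_neg_collisions_le {ι : Type*} [Fintype ι] [DecidableEq ι]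
    {p : ι → ℝ} (hp : ∀ j, 0 ≤ p j)
    (hp1 : ∑ j, p j = 1) {t η : ℝ} (ht : 0 ≤ t) {n : ℕ} (hn : 2 ≤ n) (hη : ∀ j, n * p j ≤ η) :
    (drawStep p)^[n] (fun N => Real.exp (-(t * collisions N))) 0 ≤
      Real.exp (-(t * (1 - η / 2 - t) * (n * (n - 1) * ∑ j, p j ^ 2))) := by
  have hle : ∀ j, p j ≤ 1 := fun j =>
    hp1 ▸ Finset.single_le_sum (fun i _ => hp i) (Finset.mem_univ j)
  have hn' : (2 : ℝ) ≤ n := by exact_mod_cast hn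
  set g : ℕ → ℝ := fun r => Real.exp (-(t * if 2 ≤ r then (r : ℝ) else 0)) with hg
  have hprod : (fun N : ι → ℕ => Real.exp (-(t * collisions N))) = fun N => ∏ j, g (N j) := by
    funext N
    rw [← Real.exp_sum, collisions, Finset.mul_sum, Finset.sum_neg_distrib]
  have hanti : Antitone g := by
    refine antitone_nat_of_succ_le fun r => Real.exp_le_exp.2 (neg_le_neg ?_)
    refine mul_le_mul_of_nonneg_left ?_ ht
    split_ifs
    · push_cast; linarith
    · omega
    · positivity
    · exact le_rfl
  rw [hprod]
  refine (drawStep_iterate_prod_le hp hp1 (fun _ r => Real.exp_pos _) (fun _ => hanti) n 0).trans ?_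
  rw [Finset.mul_sum, Finset.mul_sum, ← Finset.sum_neg_distrib, Real.exp_sum]
  refine Finset.prod_le_prod (fun j _ => ?_) fun j _ => ?_
  · have h0 : ∀ n r, (bernoulliStep (p j))^[n] (fun _ => 0) r = 0 := by
      intro n
      induction n with
      | zero => intro r; rfl
      | succ n ih => intro r; rw [Function.iterate_succ_apply', bernoulliStep, ih, ih]; ring
    exact (h0 n _).ge.trans (bernoulliStep_iterate_mono (hp j) (hle j)
      (fun r => (Real.exp_pos _).le) n _)
  · refine (bernoulliStep_iterate_mono (hp j) (hle j) (exp_neg_ite_le ht) n _).trans ?_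
    rw [bernoulliStep_iterate_cubic]
    refine le_trans ?_ (Real.add_one_le_exp _)
    have h1 : 0 ≤ (n : ℝ) * (n - 1) * p j ^ 2 :=
      mul_nonneg (mul_nonneg (by linarith) (by linarith)) (sq_nonneg _)
    -- The cubic term is `(n - 2) p j / 2` times `t n (n - 1) p j²`; this is the source of the loss
    -- `η / 2`.
    have h2 : ((n : ℝ) - 2) * p j ≤ η := by nlinarith [hη j, hp j]
    simp only [Pi.zero_apply, Nat.cast_zero]
    nlinarith [mul_le_mul_of_nonneg_left h2 (mul_nonneg ht h1)]

/-! ### The law of the labels -/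

lemma binLabel_lt {m : ℕ} (hm : 0 < m) (x : I) : binLabel m x < m :=
  (min_le_right _ _).trans_lt (Nat.sub_lt hm one_pos)

/-- The label of the bin that contains `x`, as an element of `Fin m`. -/
noncomputable def binIndex {m : ℕ} (hm : 0 < m) (x : I) : Fin m := ⟨binLabel m x, binLabel_lt hm x⟩

lemma measurable_binLabel (m : ℕ) : Measurable (binLabel m) :=
  (Nat.measurable_floor.comp (measurable_subtype_coe.const_mul (m : ℝ))).min measurable_const

lemma measurable_binIndex {m : ℕ} (hm : 0 < m) : Measurable (binIndex hm) := by
  refine measurable_to_countable' fun j => ?_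
  have : binIndex hm ⁻¹' {j} = binLabel m ⁻¹' {(j : ℕ)} := by
    ext x; simp [binIndex, Fin.ext_iff]
  rw [this]
  exact measurable_binLabel m (measurableSet_singleton _)

/-- The probability of a bin. -/
noncomputable def binProb (P : Measure I) {m : ℕ} (hm : 0 < m) (j : Fin m) : ℝ :=
  P.real (binIndex hm ⁻¹' {j})

lemma binProb_nonneg (P : Measure I) {m : ℕ} (hm : 0 < m) (j : Fin m) : 0 ≤ binProb P hm j :=
  measureReal_nonneg

lemma sum_binProb (P : Measure I) [IsProbabilityMeasure P] {m : ℕ} (hm : 0 < m) :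
    ∑ j, binProb P hm j = 1 := by
  simp only [binProb]
  rw [sum_measureReal_preimage_singleton]
  · simp
  · exact fun j _ => measurable_binIndex hm (measurableSet_singleton j)

lemma sampleLaw_labels_eq (P : Measure I) [IsProbabilityMeasure P] {m : ℕ} (hm : 0 < m) {n : ℕ}
    (s : Fin n → Fin m) :
    (sampleLaw P).real {x | (fun i : Fin n => binIndex hm (x i)) = s} =
      ∏ i, binProb P hm (s i) := by
  set t : ℕ → Set I := fun i => if h : i < n then binIndex hm ⁻¹' {s ⟨i, h⟩} else Set.univ with ht
  have hset : {x : ℕ → I | (fun i : Fin n => binIndex hm (x i)) = s} =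
      Set.pi (Finset.range n : Set ℕ) t := by
    ext x
    simp only [Set.mem_ofPred_eq, funext_iff, Set.mem_pi, Finset.coe_range, Set.mem_Iio, ht]
    constructor
    · intro h i hi
      simpa [hi] using h ⟨i, hi⟩
    · intro h i
      simpa using h i i.2
  have hmeas : ∀ i ∈ Finset.range n, MeasurableSet (t i) := by
    intro i hi
    simp only [ht, Finset.mem_range.1 hi, dif_pos]
    exact measurable_binIndex hm (measurableSet_singleton _)
  rw [hset, sampleLaw, Measure.real, Measure.infinitePi_pi _ hmeas, ENNReal.toReal_prod,
    Finset.prod_range]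
  refine Finset.prod_congr rfl fun i _ => ?_
  simp [ht, binProb, Measure.real]

/-- Markov's inequality for the occupancy numbers of the bins. -/
lemma sampleLaw_occupancy_le (P : Measure I) [IsProbabilityMeasure P] {m : ℕ} (hm : 0 < m) (n : ℕ)
    (Q : (Fin m → ℕ) → Prop) {G : (Fin m → ℕ) → ℝ} (hG : ∀ N, 0 ≤ G N) (hQ : ∀ N, Q N → 1 ≤ G N) :
    (sampleLaw P).real {x | Q (occupancy fun i : Fin n => binIndex hm (x i))} ≤
      (drawStep (binProb P hm))^[n] G 0 := by
  classical
  have : IsProbabilityMeasure (sampleLaw P) := by unfold sampleLaw; infer_instance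
  rw [← sum_prod_mul_occupancy]
  -- Splitting over the finitely many label sequences needs only subadditivity of the measure.
  have hsub : {x : ℕ → I | Q (occupancy fun i : Fin n => binIndex hm (x i))} ⊆
      ⋃ s ∈ Finset.univ.filter fun s : Fin n → Fin m => Q (occupancy s),
        {x | (fun i : Fin n => binIndex hm (x i)) = s} := by
    intro x hx
    simp only [Set.mem_iUnion, Finset.mem_filter]
    exact ⟨_, ⟨Finset.mem_univ _, hx⟩, rfl⟩
  refine (measureReal_mono hsub (measure_ne_top _ _)).trans
    ((measureReal_biUnion_finset_le _ _).trans ?_)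
  rw [Finset.sum_filter]
  refine Finset.sum_le_sum fun s _ => ?_
  have h0 : 0 ≤ ∏ i, binProb P hm (s i) := Finset.prod_nonneg fun i _ => binProb_nonneg P hm _
  rw [zero_add]
  split_ifs with h
  · rw [sampleLaw_labels_eq]
    exact le_mul_of_one_le_right h0 (hQ _ h)
  · exact mul_nonneg h0 (hG _)

lemma coincidence_eq {m n : ℕ} (s : Fin n → Fin m) :
    (coincidence m (fun i => (s i : ℕ)) : ℝ) = n - collisions (occupancy s) := by
  have h1 := sum_eq_collisions_add (occupancy s)
  rw [← Nat.cast_sum, sum_occupancy] at h1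
  have h2 : coincidence m (fun i => (s i : ℕ)) =
      (Finset.univ.filter fun j => occupancy s j = 1).card := by
    rw [coincidence, Finset.card_filter, Finset.card_filter, Finset.sum_range]
    simp [occupancy, Fin.ext_iff]
  rw [h1, h2]
  ring

lemma binnedCoincidence_eq {m : ℕ} (hm : 0 < m) (n : ℕ) (x : ℕ → I) :
    (binnedCoincidence n m x : ℝ) =
      n - collisions (occupancy fun i : Fin n => binIndex hm (x i)) :=
  coincidence_eq fun i : Fin n => binIndex hm (x i)

/-- The upper tail of the number of collisions, for uniform labels. -/
lemma sampleLaw_le_collisions (P : Measure I) [IsProbabilityMeasure P] {m : ℕ} (hm : 0 < m) (n : ℕ)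
    (hP : ∀ j, binProb P hm j = 1 / m) (a : ℝ) {t : ℝ} (ht : 0 ≤ t) :
    (sampleLaw P).real
        {x | a ≤ collisions (occupancy fun i : Fin n => binIndex hm (x i))} ≤
      Real.exp (1 / m * (Real.exp (2 * t) - 1) * (n * (n - 1) / 2) - t * a) := by
  refine (sampleLaw_occupancy_le P hm n (fun N => a ≤ collisions N)
    (G := fun N => Real.exp (-(t * a)) * Real.exp (t * collisions N))
    (fun N => by positivity) fun N hN => ?_).trans ?_
  · rw [← Real.exp_add, Real.one_le_exp_iff]
    nlinarith
  · rw [← sum_prod_mul_occupancy]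
    simp only [mul_left_comm _ (Real.exp (-(t * a)))]
    rw [← Finset.mul_sum, sum_prod_mul_occupancy _ fun N => Real.exp (t * collisions N)]
    refine (mul_le_mul_of_nonneg_left (drawStep_iterate_exp_collisions_le hP (by positivity)
      (sum_binProb P hm) ht n 0) (Real.exp_pos _).le).trans ?_
    rw [← Real.exp_add]
    simp [collisions]

/-- The lower tail of the number of collisions. -/
lemma sampleLaw_collisions_le (P : Measure I) [IsProbabilityMeasure P] {m : ℕ} (hm : 0 < m) {n : ℕ}
    (hn : 2 ≤ n) {η : ℝ} (hη : ∀ j, n * binProb P hm j ≤ η) (a : ℝ) {t : ℝ} (ht : 0 ≤ t) :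
    (sampleLaw P).real
        {x | collisions (occupancy fun i : Fin n => binIndex hm (x i)) ≤ a} ≤
      Real.exp (t * a - t * (1 - η / 2 - t) * (n * (n - 1) * ∑ j, binProb P hm j ^ 2)) := by
  refine (sampleLaw_occupancy_le P hm n (fun N => collisions N ≤ a)
    (G := fun N => Real.exp (t * a) * Real.exp (-(t * collisions N)))
    (fun N => by positivity) fun N hN => ?_).trans ?_
  · rw [← Real.exp_add, Real.one_le_exp_iff]
    nlinarith
  · rw [← sum_prod_mul_occupancy]
    simp only [mul_left_comm _ (Real.exp (t * a))]
    rw [← Finset.mul_sum, sum_prod_mul_occupancy _ fun N => Real.exp (-(t * collisions N))]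
    refine (mul_le_mul_of_nonneg_left (drawStep_iterate_exp_neg_collisions_le
      (binProb_nonneg P hm) (sum_binProb P hm) ht hn hη) (Real.exp_pos _).le).trans ?_
    rw [← Real.exp_add, ← sub_eq_add_neg]

/-! ### The expected coincidence number -/

/-- Choose the one position with label `j`; the other `n - 1` positions take any of the remaining `m
- 1` labels. -/
lemma card_filter_occupancy_eq_one {m n : ℕ} (j : Fin m) :
    (Finset.univ.filter fun s : Fin n → Fin m => occupancy s j = 1).card =
      n * (m - 1) ^ (n - 1) := by
  classical
  have h : (Finset.univ.filter fun s : Fin n → Fin m => occupancy s j = 1) =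
      Finset.univ.biUnion fun i : Fin n =>
        Fintype.piFinset fun i' => if i' = i then {j} else Finset.univ.erase j := by
    ext s
    simp only [Finset.mem_filter, Finset.mem_univ, true_and, Finset.mem_biUnion,
      Fintype.mem_piFinset, occupancy, Finset.card_eq_one, Finset.ext_iff, Finset.mem_singleton]
    refine exists_congr fun i => forall_congr' fun i' => ?_
    split_ifs with hi <;> simp [hi]
  rw [h, Finset.card_biUnion]
  · have : ∀ i : Fin n, (Fintype.piFinset fun i' =>
        if i' = i then ({j} : Finset (Fin m)) else Finset.univ.erase j).card =
          (m - 1) ^ (n - 1) := by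
      intro i
      rw [Fintype.card_piFinset, ← Finset.mul_prod_erase _ _ (Finset.mem_univ i),
        Finset.prod_congr rfl (g := fun _ => m - 1)]
      · simp
      · intro i' hi'
        simp [(Finset.mem_erase.1 hi').1]
    simp [this]
  · intro i _ i' _ hii
    rw [Function.onFun, Finset.disjoint_left]
    intro s hs hs'
    have h1 := Fintype.mem_piFinset.1 hs i
    have h2 := Fintype.mem_piFinset.1 hs' i
    rw [if_pos rfl, Finset.mem_singleton] at h1
    rw [if_neg hii, h1] at h2
    simp at h2

lemma expectedCoincidence_eq {m : ℕ} (hm : 0 < m) (n : ℕ) :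
    expectedCoincidence n m = n * (1 - 1 / (m : ℝ)) ^ (n - 1) := by
  have hm' : (m : ℝ) ≠ 0 := by exact_mod_cast hm.ne'
  have h : ∑ s : Fin n → Fin m, coincidence m (fun i => (s i : ℕ)) =
      m * (n * (m - 1) ^ (n - 1)) := by
    have h2 : ∀ s : Fin n → Fin m, coincidence m (fun i => (s i : ℕ)) =
        ∑ j, if occupancy s j = 1 then 1 else 0 := by
      intro s
      rw [coincidence, Finset.card_filter, Finset.sum_range]
      simp [occupancy, Fin.ext_iff]
    simp only [h2]
    rw [Finset.sum_comm]
    simp [card_filter_occupancy_eq_one]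
  rw [expectedCoincidence, ← Nat.cast_sum, h]
  push_cast [Nat.cast_sub hm]
  rcases n with _ | n
  · simp
  · rw [one_sub_div hm', div_pow, Nat.add_sub_cancel]
    field_simp
    ring

lemma expectedCoincidence_ge {m : ℕ} (hm : 0 < m) {n : ℕ} (hn : 1 ≤ n) :
    n - n * (n - 1) / (m : ℝ) ≤ expectedCoincidence n m := by
  have hm' : (1 : ℝ) ≤ m := by exact_mod_cast hm
  rw [expectedCoincidence_eq hm]
  have h := one_add_mul_le_pow (a := -(1 / (m : ℝ))) (by
    have : 1 / (m : ℝ) ≤ 1 := by rw [div_le_one] <;> linarith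
    linarith) (n - 1)
  rw [Nat.cast_sub hn, Nat.cast_one] at h
  have h2 := mul_le_mul_of_nonneg_left h (Nat.cast_nonneg n : (0 : ℝ) ≤ n)
  calc _ = (n : ℝ) * (1 + (n - 1) * -(1 / (m : ℝ))) := by ring
    _ ≤ _ := by rwa [← sub_eq_add_neg] at h2

/-- A second-order Bonferroni bound, with `k²` in place of `k (k - 1)`. It keeps `n - c_u` close to
`μ` from below, as the false alarm bound requires. -/
lemma one_sub_pow_le {q : ℝ} (h0 : 0 ≤ q) (h1 : q ≤ 1) (k : ℕ) :
    (1 - q) ^ k ≤ 1 - k * q + k ^ 2 * q ^ 2 / 2 := by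
  induction k with
  | zero => simp
  | succ k ih =>
    have h := one_add_mul_le_pow (a := -q) (by linarith) k
    rw [pow_succ]
    push_cast
    nlinarith [sq_nonneg q, mul_le_mul_of_nonneg_right ih (sub_nonneg.2 h1), pow_nonneg h0 3,
      mul_nonneg (mul_nonneg (Nat.cast_nonneg k : (0 : ℝ) ≤ k) (Nat.cast_nonneg k : (0 : ℝ) ≤ k))
        (pow_nonneg h0 3)]

lemma expectedCoincidence_le {m : ℕ} (hm : 0 < m) {n : ℕ} (hn : 1 ≤ n) :
    expectedCoincidence n m ≤ n - n * (n - 1) / (m : ℝ) + n ^ 3 / (2 * m ^ 2) := by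
  have hm' : (1 : ℝ) ≤ m := by exact_mod_cast hm
  have hn' : (1 : ℝ) ≤ n := by exact_mod_cast hn
  rw [expectedCoincidence_eq hm]
  have h := one_sub_pow_le (q := 1 / (m : ℝ)) (by positivity)
    (by rw [div_le_one] <;> linarith) (n - 1)
  rw [Nat.cast_sub hn, Nat.cast_one] at h
  calc (n : ℝ) * (1 - 1 / (m : ℝ)) ^ (n - 1)
      ≤ n * (1 - (n - 1) * (1 / (m : ℝ)) + n ^ 2 * (1 / (m : ℝ)) ^ 2 / 2) := by
        refine mul_le_mul_of_nonneg_left (h.trans ?_) (by linarith)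
        gcongr
        linarith
    _ = _ := by field_simp

/-! ### Bins -/

/-- The upper bound is conditional because the last bin contains its right endpoint. -/
lemma binIndex_eq_iff {m : ℕ} (hm : 0 < m) (x : I) (j : Fin m) :
    binIndex hm x = j ↔
      (j : ℝ) / m ≤ x ∧ ((j : ℕ) + 1 < m → (x : ℝ) < ((j : ℕ) + 1) / m) := by
  have hm' : (0 : ℝ) < m := by exact_mod_cast hm
  have hx : 0 ≤ (m : ℝ) * x := mul_nonneg hm'.le x.2.1
  have hj := j.2
  rw [div_le_iff₀ hm', lt_div_iff₀ hm', mul_comm (x : ℝ)]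
  rw [Fin.ext_iff]
  simp only [binIndex, binLabel]
  rw [← Nat.le_floor_iff hx]
  have h3 : ((m : ℝ) * x < (j : ℕ) + 1) ↔ ⌊(m : ℝ) * x⌋₊ < (j : ℕ) + 1 := by
    rw [Nat.floor_lt hx]
    push_cast
    rfl
  rw [h3]
  omega

lemma volume_real_bin {m : ℕ} (hm : 0 < m) (j : Fin m) :
    (volume : Measure I).real (binIndex hm ⁻¹' {j}) = 1 / m := by
  have hm' : (0 : ℝ) < m := by exact_mod_cast hm
  have hj : ((j : ℕ) : ℝ) + 1 ≤ m := by exact_mod_cast j.2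
  have h1 : ((j : ℕ) : ℝ) / m ∈ I :=
    ⟨by positivity, by rw [div_le_one hm']; linarith⟩
  rcases (Nat.succ_le_of_lt j.2).eq_or_lt with h | h
  · have : binIndex hm ⁻¹' {j} = Set.Ici (⟨_, h1⟩ : I) := by
      ext x
      rw [Set.mem_preimage, Set.mem_singleton_iff, binIndex_eq_iff, Set.mem_Ici, ← Subtype.coe_le_coe]
      exact ⟨fun h => h.1, fun h' => ⟨h', fun h'' => absurd h'' (by omega)⟩⟩
    have hj' : ((j : ℕ) : ℝ) = m - 1 := by
      rw [eq_sub_iff_add_eq]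
      exact_mod_cast h
    rw [this, Measure.real, unitInterval.volume_Ici, ENNReal.toReal_ofReal (by linarith [h1.2])]
    simp only [hj']
    field_simp
    ring
  · have h2 : (((j : ℕ) : ℝ) + 1) / m ∈ I :=
      ⟨by positivity, by rw [div_le_one hm']; exact hj⟩
    have : binIndex hm ⁻¹' {j} = Set.Ico (⟨_, h1⟩ : I) ⟨_, h2⟩ := by
      ext x
      rw [Set.mem_preimage, Set.mem_singleton_iff, binIndex_eq_iff, Set.mem_Ico,
        ← Subtype.coe_le_coe, ← Subtype.coe_lt_coe]
      exact ⟨fun h' => ⟨h'.1, h'.2 h⟩, fun h' => ⟨h'.1, fun _ => h'.2⟩⟩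
    rw [this, Measure.real, unitInterval.volume_Ico, ENNReal.toReal_ofReal]
    · simp only []
      field_simp
      ring
    · simp only [sub_nonneg]
      gcongr
      linarith

lemma dist_le_of_binIndex_eq {m : ℕ} (hm : 0 < m) {x y : I} (h : binIndex hm x = binIndex hm y) :
    dist x y ≤ 1 / m := by
  have hm' : (0 : ℝ) < m := by exact_mod_cast hm
  have key : ∀ z : I, binIndex hm z = binIndex hm y →
      ((binIndex hm y : ℕ) : ℝ) / m ≤ z ∧ (z : ℝ) ≤ ((binIndex hm y : ℕ) : ℝ) / m + 1 / m := by
    intro z hz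
    obtain ⟨h1, h2⟩ := (binIndex_eq_iff hm z _).1 hz
    refine ⟨h1, ?_⟩
    rw [← add_div]
    rcases (Nat.succ_le_of_lt (binIndex hm y).2).eq_or_lt with h | h
    · have : ((binIndex hm y : ℕ) : ℝ) + 1 = m := by exact_mod_cast h
      rw [this, div_self hm'.ne']
      exact z.2.2
    · exact (h2 h).le
  obtain ⟨hx1, hx2⟩ := key x h
  obtain ⟨hy1, hy2⟩ := key y rfl
  rw [Subtype.dist_eq, Real.dist_eq, abs_le]
  constructor <;> linarith

/-! ### Lipschitz densities -/

section Density

variable {L : ℝ≥0} {P : Measure I} [IsProbabilityMeasure P] {f : I → ℝ}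

lemma HasLipschitzDensity.integrable (h : HasLipschitzDensity L P f) : Integrable f volume :=
  h.lipschitz.continuous.integrable_of_hasCompactSupport (HasCompactSupport.of_compactSpace f)

lemma HasLipschitzDensity.measureReal_eq (h : HasLipschitzDensity L P f) {A : Set I}
    (hA : MeasurableSet A) : P.real A = ∫ x in A, f x := by
  rw [Measure.real, h.eq_withDensity, withDensity_apply _ hA,
    integral_eq_lintegral_of_nonneg_ae (Filter.Eventually.of_forall h.nonneg)
      h.integrable.aestronglyMeasurable.restrict]

lemma HasLipschitzDensity.integral_eq_one (h : HasLipschitzDensity L P f) : ∫ x, f x = 1 := by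
  rw [← setIntegral_univ, ← h.measureReal_eq MeasurableSet.univ]
  simp

lemma HasLipschitzDensity.abs_sub_le (h : HasLipschitzDensity L P f) {x y : I} {d : ℝ}
    (hxy : dist x y ≤ d) : |f x - f y| ≤ L * d := by
  rw [← Real.dist_eq]
  exact (h.lipschitz.dist_le_mul x y).trans (by gcongr)

lemma HasLipschitzDensity.l1DistUniform_le_two (h : HasLipschitzDensity L P f) :
    l1DistUniform f ≤ 2 := by
  have h1 : ∫ x : I, (f x + 1) = 2 := by
    rw [integral_add h.integrable (integrable_const _), h.integral_eq_one]
    norm_num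
  rw [← h1]
  refine integral_mono (h.integrable.sub (integrable_const _)).abs
    (h.integrable.add (integrable_const _)) fun x => ?_
  have := h.nonneg x
  simp only []
  rw [abs_le]
  constructor <;> linarith

/-- An interval of length `w` with endpoint `x` fits into `[0,1]` on one side of `x`. The density is
at least `f x - L w` there, and the interval has mass at most 1. -/
lemma HasLipschitzDensity.mul_le_one (h : HasLipschitzDensity L P f) (x : I) {w : ℝ} (hw : 0 ≤ w)
    (hw2 : w ≤ 1 / 2) : w * (f x - L * w) ≤ 1 := by
  have key : ∀ a b : I, (b : ℝ) - a = w → (∀ y ∈ Set.Icc a b, dist x y ≤ w) →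
      w * (f x - L * w) ≤ 1 := by
    intro a b hab hy
    have hv : (volume : Measure I).real (Set.Icc a b) = w := by
      rw [Measure.real, unitInterval.volume_Icc, ENNReal.toReal_ofReal] <;> linarith
    calc w * (f x - L * w) = ∫ _ in Set.Icc a b, (f x - L * w) := by
          rw [setIntegral_const, hv, smul_eq_mul]
      _ ≤ ∫ y in Set.Icc a b, f y := by
          refine setIntegral_mono_on (integrable_const _) h.integrable.integrableOn
            measurableSet_Icc fun y hyI => ?_
          have := h.abs_sub_le (hy y hyI)
          rw [abs_le] at this
          linarith [this.2]
      _ = P.real (Set.Icc a b) := (h.measureReal_eq measurableSet_Icc).symm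
      _ ≤ 1 := measureReal_le_one
  have hx0 := x.2.1
  have hx1 := x.2.2
  rcases le_total (x : ℝ) (1 / 2) with hx | hx
  · refine key x ⟨x + w, by constructor <;> linarith⟩ (by simp) fun y hy => ?_
    have h1 : (x : ℝ) ≤ y := hy.1
    have h2 : (y : ℝ) ≤ x + w := hy.2
    rw [Subtype.dist_eq, Real.dist_eq, abs_le]
    constructor <;> linarith
  · refine key ⟨x - w, by constructor <;> linarith⟩ x (by simp) fun y hy => ?_
    have h1 : (x : ℝ) - w ≤ y := hy.1
    have h2 : (y : ℝ) ≤ x := hy.2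
    rw [Subtype.dist_eq, Real.dist_eq, abs_le]
    constructor <;> linarith

/-- The width `w = 1/√c` balances `1/w` against `L w`. The resulting sup bound keeps the expected
count of every bin of order `1/k`, which is the `η` of the lower tail. -/
lemma HasLipschitzDensity.le_two_mul_sqrt (h : HasLipschitzDensity L P f) {c : ℝ} (hc : 4 ≤ c)
    (hL : 2 * (L : ℝ) ≤ c) (x : I) : f x ≤ 2 * √c := by
  have hs : 2 ≤ √c := Real.le_sqrt_of_sq_le (by norm_num [hc])
  have hs2 : √c * √c = c := Real.mul_self_sqrt (by linarith)
  have h1 := h.mul_le_one x (w := 1 / √c) (by positivity) (by gcongr)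
  have h2 : f x - L * (1 / √c) ≤ √c := by
    rw [one_div, inv_mul_le_iff₀ (by linarith)] at h1
    simpa using h1
  have h3 : (L : ℝ) * (1 / √c) ≤ √c := by
    rw [mul_one_div, div_le_iff₀ (by linarith), hs2]
    nlinarith [L.2]
  linarith

lemma HasLipschitzDensity.binProb_le (h : HasLipschitzDensity L P f) {m : ℕ} (hm : 0 < m) {M : ℝ}
    (hM : ∀ x, f x ≤ M) (j : Fin m) : binProb P hm j ≤ M / m := by
  have hmeas : MeasurableSet (binIndex hm ⁻¹' {j}) :=
    measurable_binIndex hm (measurableSet_singleton j)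
  rw [binProb, h.measureReal_eq hmeas]
  refine (setIntegral_mono h.integrable.integrableOn (integrable_const M) hM).trans ?_
  rw [setIntegral_const, volume_real_bin, smul_eq_mul]
  exact le_of_eq (by ring)

/-- The mean of `f` over the bin is `m p_j`, and `f` stays within `L/m` of it; integrate over length
`1/m`. -/
lemma HasLipschitzDensity.setIntegral_bin_le (h : HasLipschitzDensity L P f) {m : ℕ} (hm : 0 < m)
    (j : Fin m) :
    ∫ x in binIndex hm ⁻¹' {j}, |f x - 1| ≤ |binProb P hm j - 1 / m| + L / m ^ 2 := by
  have hm' : (0 : ℝ) < m := by exact_mod_cast hm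
  have hmeas : MeasurableSet (binIndex hm ⁻¹' {j}) :=
    measurable_binIndex hm (measurableSet_singleton j)
  have hconst : ∀ c : ℝ, ∫ _ in binIndex hm ⁻¹' {j}, c = c / m := fun c => by
    rw [setIntegral_const, volume_real_bin, smul_eq_mul, one_div_mul_eq_div]
  have hfx : ∀ x ∈ binIndex hm ⁻¹' {j}, |f x - 1| ≤ m * |binProb P hm j - 1 / m| + L / m := by
    intro x hx
    have hd : ∀ y ∈ binIndex hm ⁻¹' {j}, |f x - f y| ≤ L * (1 / m) := fun y hy =>
      h.abs_sub_le (dist_le_of_binIndex_eq hm ((show _ = j from hx).trans (show _ = j from hy).symm))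
    have h1 : (f x - L * (1 / m)) / m ≤ binProb P hm j := by
      rw [binProb, h.measureReal_eq hmeas, ← hconst]
      refine setIntegral_mono_on (integrable_const _) h.integrable.integrableOn hmeas
        fun y hy => ?_
      linarith [(abs_le.1 (hd y hy)).2]
    have h2 : binProb P hm j ≤ (f x + L * (1 / m)) / m := by
      rw [binProb, h.measureReal_eq hmeas, ← hconst]
      refine setIntegral_mono_on h.integrable.integrableOn (integrable_const _) hmeas
        fun y hy => ?_
      linarith [(abs_le.1 (hd y hy)).1]
    rw [div_le_iff₀ hm', mul_one_div] at h1
    rw [le_div_iff₀ hm', mul_one_div] at h2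
    have h3 : (m : ℝ) * |binProb P hm j - 1 / m| = |binProb P hm j * m - 1| := by
      rw [← abs_of_pos hm', ← abs_mul, abs_of_pos hm', mul_sub, mul_one_div, div_self hm'.ne',
        mul_comm]
    rw [h3]
    have h4 := neg_abs_le (binProb P hm j * m - 1)
    have h5 := le_abs_self (binProb P hm j * m - 1)
    rw [abs_le]
    constructor <;> linarith
  calc ∫ x in binIndex hm ⁻¹' {j}, |f x - 1|
      ≤ ∫ _ in binIndex hm ⁻¹' {j}, (m * |binProb P hm j - 1 / m| + L / m) :=
        setIntegral_mono_on (h.integrable.sub (integrable_const _)).abs.integrableOn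
          (integrable_const _) hmeas hfx
    _ = _ := by
        rw [hconst]
        field_simp

lemma HasLipschitzDensity.l1DistUniform_le (h : HasLipschitzDensity L P f) {m : ℕ} (hm : 0 < m) :
    l1DistUniform f ≤ ∑ j, |binProb P hm j - 1 / m| + L / m := by
  have hm' : (0 : ℝ) < m := by exact_mod_cast hm
  have hU : (⋃ j, binIndex hm ⁻¹' {j}) = Set.univ := by
    ext x; simp
  rw [l1DistUniform, ← setIntegral_univ, ← hU, integral_iUnion_fintype]
  · refine (Finset.sum_le_sum fun j _ => h.setIntegral_bin_le hm j).trans ?_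
    rw [Finset.sum_add_distrib]
    simp only [Finset.sum_const, Finset.card_univ, Fintype.card_fin, nsmul_eq_mul]
    refine le_of_eq (congrArg _ ?_)
    field_simp
  · exact fun j => measurable_binIndex hm (measurableSet_singleton j)
  · intro i j hij
    exact Disjoint.preimage _ (by simpa using hij)
  · exact fun j => (h.integrable.sub (integrable_const _)).abs.integrableOn

/-- Binning loses at most half of the `ℓ₁` distance. Cauchy-Schwarz turns the rest into `∑ (p_j -
1/m)² = ∑ p_j² - 1/m`. -/
lemma HasLipschitzDensity.le_sum_binProb_sq (h : HasLipschitzDensity L P f) {m : ℕ} (hm : 0 < m)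
    (hL : (L : ℝ) / m ≤ l1DistUniform f / 2) (h0 : 0 ≤ l1DistUniform f) :
    (1 + l1DistUniform f ^ 2 / 4) / m ≤ ∑ j, binProb P hm j ^ 2 := by
  have hm' : (0 : ℝ) < m := by exact_mod_cast hm
  have h1 := h.l1DistUniform_le hm
  have h2 : l1DistUniform f / 2 ≤ ∑ j, |binProb P hm j - 1 / m| := by linarith
  have h3 := sq_sum_le_card_mul_sum_sq (s := Finset.univ)
    (f := fun j => |binProb P hm j - 1 / m|)
  have h4 : ∑ j, (binProb P hm j - 1 / m) ^ 2 = ∑ j, binProb P hm j ^ 2 - 1 / m := by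
    simp only [sub_sq, Finset.sum_add_distrib, Finset.sum_sub_distrib, ← Finset.sum_mul,
      ← Finset.mul_sum, sum_binProb]
    simp
    field_simp
    ring
  simp only [sq_abs, Finset.card_univ, Fintype.card_fin] at h3
  rw [h4] at h3
  rw [div_le_iff₀ hm']
  have h5 := pow_le_pow_left₀ (by linarith) h2 2
  have h6 : (m : ℝ) * (∑ j, binProb P hm j ^ 2 - 1 / m) = (∑ j, binProb P hm j ^ 2) * m - 1 := by
    field_simp
  nlinarith

end Density

/-! ### The parameters of an epoch -/

lemma one_le_log_add {δ : ℝ} (hδ : 0 < δ) (hδ1 : δ < 1) {k : ℕ} (hk : 1 ≤ k) :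
    1 ≤ Real.log (k + 2 / δ) := by
  have hk' : (1 : ℝ) ≤ k := by exact_mod_cast hk
  have h2 : 2 ≤ 2 / δ := by rw [le_div_iff₀ hδ]; linarith
  rw [Real.le_log_iff_exp_le (by linarith)]
  linarith [Real.exp_one_lt_d9]

lemma le_sqrt_of_le {c₀ : ℝ} (hc : 28212 ≤ c₀) : 167 ≤ √c₀ :=
  Real.le_sqrt_of_sq_le (by linarith)

/-- Estimates for `n ≈ s k³ l` samples in `m ≈ s² k⁴ l` bins. -/
lemma sample_bin_estimates {s k l n m : ℝ} (hs : 167 ≤ s) (hk : 1 ≤ k) (hl : 1 ≤ l)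
    (hn : s * k ^ 3 * l ≤ n) (hn' : n ≤ s * k ^ 3 * l + 1) (hm : s ^ 2 * k ^ 4 * l ≤ m)
    (hm' : m ≤ s ^ 2 * k ^ 4 * l + 1) :
    n * (n - 1) / m ≤ 1.02 * (k ^ 2 * l) ∧ 0.98 * (k ^ 2 * l) ≤ n * (n - 1) / m ∧
      n * s / m ≤ 1.01 / k ∧ n ^ 3 / (2 * m ^ 2) ≤ 0.01 * (k * l) ∧
      8.91 * (k * l) ≤ 9 * n * √(l / m) ∧ 9 * n * √(l / m) ≤ 9.1 * (k * l) := by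
  have hk3 : 1 ≤ k ^ 3 := one_le_pow₀ hk
  have hk4 : 1 ≤ k ^ 4 := one_le_pow₀ hk
  have hkl : 1 ≤ k * l := by nlinarith
  have hB : 167 ≤ s * k ^ 3 * l := by
    have : 1 ≤ k ^ 3 * l := by nlinarith
    nlinarith
  have hA : 20000 ≤ s ^ 2 * k ^ 4 * l := by
    have h1 : 1 ≤ k ^ 4 * l := by nlinarith
    have h2 : 20000 ≤ s ^ 2 := by nlinarith
    nlinarith
  -- `B` and `A` are the sample and bin numbers before rounding up. They are so large that rounding
  -- costs relative errors of at most 0.006 and 0.001.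
  set B := s * k ^ 3 * l with hBdef
  set A := s ^ 2 * k ^ 4 * l with hAdef
  have hBA : B ^ 2 = k ^ 2 * l * A := by rw [hBdef, hAdef]; ring
  have hBA' : B * s * k = A := by rw [hBdef, hAdef]; ring
  have hm0 : 0 < m := by linarith
  have hn0 : 0 ≤ n := by linarith
  have hn1 : n ≤ 1.006 * B := by linarith
  have hn2 : 0.994 * B ≤ n - 1 := by linarith
  have hm1 : m ≤ 1.001 * A := by linarith
  have hk2l : 0 < k ^ 2 * l := by positivity
  have h1 : n * (n - 1) / m ≤ 1.02 * (k ^ 2 * l) := by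
    rw [div_le_iff₀ hm0]
    have : n * (n - 1) ≤ (1.006 * B) * (1.006 * B) :=
      mul_le_mul hn1 (by linarith) (by linarith) (by linarith)
    nlinarith
  have h3 : n * s / m ≤ 1.01 / k := by
    rw [div_le_div_iff₀ hm0 (by linarith)]
    nlinarith [mul_le_mul_of_nonneg_right hn1 (by positivity : 0 ≤ s * k)]
  have hsq : 0 < s * k ^ 2 := by positivity
  have h5 : 0.99 / (s * k ^ 2) ≤ √(l / m) := by
    apply Real.le_sqrt_of_sq_le
    rw [div_pow, div_le_div_iff₀ (by positivity) hm0]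
    have : l * (s * k ^ 2) ^ 2 = A := by rw [hAdef]; ring
    nlinarith
  have h6 : √(l / m) ≤ 1 / (s * k ^ 2) := by
    apply Real.sqrt_le_iff.2 ⟨by positivity, ?_⟩
    rw [div_pow, div_le_div_iff₀ hm0 (by positivity)]
    have : l * (s * k ^ 2) ^ 2 = A := by rw [hAdef]; ring
    linarith
  have hBk : B / (s * k ^ 2) = k * l := by
    rw [hBdef]; field_simp
  refine ⟨h1, ?_, h3, ?_, ?_, ?_⟩
  · rw [le_div_iff₀ hm0]
    have : B * (0.994 * B) ≤ n * (n - 1) := mul_le_mul hn hn2 (by linarith) (by linarith)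
    nlinarith
  · have hns : n / m ≤ 1.01 / k / s := by
      rw [le_div_iff₀ (by linarith)]
      exact le_of_eq_of_le (by ring) h3
    have hnn : n ^ 2 / m ≤ 1.02 * (k ^ 2 * l) := by
      rw [div_le_iff₀ hm0]
      nlinarith [pow_le_pow_left₀ (by linarith) hn1 2]
    calc n ^ 3 / (2 * m ^ 2) = (n ^ 2 / m) * (n / m) / 2 := by field_simp
      _ ≤ (1.02 * (k ^ 2 * l)) * (1.01 / k / s) / 2 := by
        gcongr
      _ = (k * l) * (1.02 * 1.01 / 2 / s) := by field_simp
      _ ≤ (k * l) * 0.01 := by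
        gcongr
        rw [div_le_iff₀ (by linarith)]
        linarith
      _ = _ := by ring
  · calc 8.91 * (k * l) = 9 * B * (0.99 / (s * k ^ 2)) := by rw [← hBk]; ring
      _ ≤ _ := by gcongr
  · calc 9 * n * √(l / m) ≤ 9 * (1.006 * B) * (1 / (s * k ^ 2)) := by gcongr
      _ = 9.054 * (k * l) := by rw [← hBk]; ring
      _ ≤ _ := by linarith

lemma numSamples_numBins_bounds {c₀ δ : ℝ} (hc : 28212 ≤ c₀) (hδ : 0 < δ) (hδ1 : δ < 1) {k : ℕ}
    (hk : 1 ≤ k) :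
    (√c₀ * k ^ 3 * Real.log (k + 2 / δ) ≤ numSamples c₀ δ k ∧
      numSamples c₀ δ k ≤ √c₀ * k ^ 3 * Real.log (k + 2 / δ) + 1) ∧
    (√c₀ ^ 2 * k ^ 4 * Real.log (k + 2 / δ) ≤ numBins c₀ δ k ∧
      numBins c₀ δ k ≤ √c₀ ^ 2 * k ^ 4 * Real.log (k + 2 / δ) + 1) := by
  have hl := one_le_log_add hδ hδ1 hk
  rw [Real.sq_sqrt (by linarith)]
  exact ⟨⟨Nat.le_ceil _, (Nat.ceil_lt_add_one (by positivity)).le⟩,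
    ⟨Nat.le_ceil _, (Nat.ceil_lt_add_one (by positivity)).le⟩⟩

lemma exp_neg_nat_mul_log {x : ℝ} (hx : 0 < x) (r : ℕ) :
    Real.exp (-(r * Real.log x)) = 1 / x ^ r := by
  rw [Real.exp_neg, Real.exp_nat_mul, Real.exp_log hx, one_div]

/-! ### The exit probabilities -/

lemma two_le_numSamples {c₀ δ : ℝ} (hc : 28212 ≤ c₀) (hδ : 0 < δ) (hδ1 : δ < 1) {k : ℕ}
    (hk : 1 ≤ k) : 2 ≤ numSamples c₀ δ k ∧ 0 < numBins c₀ δ k := by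
  obtain ⟨⟨h1, -⟩, h2, -⟩ := numSamples_numBins_bounds hc hδ hδ1 hk
  have hl := one_le_log_add hδ hδ1 hk
  have hs := le_sqrt_of_le hc
  have hk' : (1 : ℝ) ≤ k := by exact_mod_cast hk
  have h3 : 1 ≤ (k : ℝ) ^ 3 * Real.log (k + 2 / δ) := one_le_mul_of_one_le_of_one_le
    (one_le_pow₀ hk') hl
  constructor
  · have : (2 : ℝ) ≤ numSamples c₀ δ k := by nlinarith
    exact_mod_cast this
  · have h4 : 0 < √c₀ ^ 2 * (k : ℝ) ^ 4 * Real.log (k + 2 / δ) := by positivity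
    exact_mod_cast h4.trans_le h2

/-- The probability of a false alarm in epoch `k`. -/
lemma sampleLaw_volume_exits_le {c₀ δ : ℝ} (hc : 28212 ≤ c₀) (hδ : 0 < δ) (hδ1 : δ < 1) {k : ℕ}
    (hk : 1 ≤ k) :
    (sampleLaw (volume : Measure I)).real {x | Exits c₀ δ x k} ≤ 1 / (k + 2 / δ) ^ 2 := by
  obtain ⟨hn2, hm⟩ := two_le_numSamples hc hδ hδ1 hk
  obtain ⟨⟨hn, hn'⟩, hmA, hmA'⟩ := numSamples_numBins_bounds hc hδ hδ1 hk
  have hl := one_le_log_add hδ hδ1 hk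
  have hk' : (1 : ℝ) ≤ k := by exact_mod_cast hk
  obtain ⟨h1, h2, h3, h4, h5, h6⟩ :=
    sample_bin_estimates (le_sqrt_of_le hc) hk' hl hn hn' hmA hmA'
  have hcu := expectedCoincidence_le hm (n := numSamples c₀ δ k) (by omega)
  have : IsProbabilityMeasure (sampleLaw (volume : Measure I)) := by
    unfold sampleLaw; infer_instance
  have hthr : threshold c₀ δ k = 9 * (numSamples c₀ δ k : ℝ) *
    √(Real.log (k + 2 / δ) / (numBins c₀ δ k : ℝ)) := rfl
  rw [← hthr] at h5
  simp only [Exits, binnedCoincidence_eq hm]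
  generalize numSamples c₀ δ k = n at *
  generalize numBins c₀ δ k = m at *
  generalize hldef : Real.log (k + 2 / δ) = l at *
  have hx : (0 : ℝ) < k + 2 / δ := by positivity
  have he : Real.exp (2 * (1 / (2 * k))) - 1 ≤ 1 / k + (1 / k) ^ 2 := by
    have h7 : 2 * (1 / (2 * (k : ℝ))) = 1 / k := by field_simp
    rw [h7]
    have h8 : |1 / (k : ℝ)| ≤ 1 := by
      rw [abs_of_nonneg (by positivity), div_le_one (by linarith)]
      exact hk'
    linarith [le_abs_self (Real.exp (1 / (k : ℝ)) - 1 - 1 / k), Real.abs_exp_sub_one_sub_id_le h8]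
  have hn1 : (2 : ℝ) ≤ n := by exact_mod_cast hn2
  have hm1 : (0 : ℝ) < m := by exact_mod_cast hm
  set μ := (n : ℝ) * (n - 1) / m with hμ
  have hμ0 : 0 ≤ μ := div_nonneg (mul_nonneg (by linarith) (by linarith)) hm1.le
  -- With `t = 1/(2k)` the first-order terms `μ/(2k)` cancel. The second-order term is about `l/2`,
  -- against a gain of `4.45 l` from the threshold; only `2 l` is needed.
  refine le_trans (measureReal_mono ?_) ((sampleLaw_le_collisions volume hm n
    (volume_real_bin hm) (μ + 8.9 * (k * l)) (t := 1 / (2 * k)) (by positivity)).trans ?_)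
  · intro x hx
    simp only [Set.mem_ofPred_eq] at hx ⊢
    linarith
  · rw [← exp_neg_nat_mul_log hx, Real.exp_le_exp, hldef]
    calc 1 / (m : ℝ) * (Real.exp (2 * (1 / (2 * k))) - 1) * (n * (n - 1) / 2) -
          1 / (2 * k) * (μ + 8.9 * (k * l))
        = μ / 2 * (Real.exp (2 * (1 / (2 * k))) - 1) - 1 / (2 * k) * (μ + 8.9 * (k * l)) := by
          rw [hμ]; ring
      _ ≤ μ / 2 * (1 / k + (1 / k) ^ 2) - 1 / (2 * k) * (μ + 8.9 * (k * l)) := by gcongr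
      _ = μ / k ^ 2 / 2 - 4.45 * l := by field_simp; ring
      _ ≤ 1.02 * l / 2 - 4.45 * l := by
          gcongr
          rw [div_le_iff₀ (by positivity)]
          linarith
      _ ≤ _ := by push_cast; linarith

/-- The lower-tail exponent at `t = 1/k`, `η = 2.1/k`. The corrections `η/2 + t` cost `2.05/k` of
the relative excess `72/k`; at least `68/k` survives, worth more than `66 l` against the threshold's
`9.1 l`. -/
lemma lower_tail_exponent_le {k l μ q : ℝ} (hk : 144 ≤ k) (hμ : 0.98 * (k ^ 2 * l) ≤ μ)
    (hq : μ * (1 + 72 / k) ≤ q) (hl : 0 ≤ l) :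
    1 / k * (μ + 9.1 * (k * l)) - 1 / k * (1 - 2.1 / k / 2 - 1 / k) * q ≤ -(57 * l) := by
  have hk0 : 0 < k := by linarith
  have hμ0 : 0 ≤ μ := le_trans (by positivity) hμ
  have hc : 1 - 2.1 / k / 2 - 1 / k = (k - 2.05) / k := by
    field_simp
    ring
  have hcoef : 0 ≤ 1 / k * ((k - 2.05) / k) :=
    mul_nonneg (by positivity) (div_nonneg (by linarith) hk0.le)
  have hμk : 0.98 * l ≤ μ / k ^ 2 := by
    rw [le_div_iff₀ (by positivity)]
    linarith
  have hbr : 68 / k ≤ (k - 2.05) / k * (1 + 72 / k) - 1 := by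
    have h7 : (k - 2.05) / k * (1 + 72 / k) - 1 - 68 / k = (1.95 * k - 147.6) / k ^ 2 := by
      field_simp
      ring
    have h8 : 0 ≤ (1.95 * k - 147.6) / k ^ 2 := div_nonneg (by linarith) (by positivity)
    linarith
  rw [hc]
  calc 1 / k * (μ + 9.1 * (k * l)) - 1 / k * ((k - 2.05) / k) * q
      ≤ 1 / k * (μ + 9.1 * (k * l)) - 1 / k * ((k - 2.05) / k) * (μ * (1 + 72 / k)) :=
        sub_le_sub_left (mul_le_mul_of_nonneg_left hq hcoef) _
    _ = 9.1 * l - μ / k * ((k - 2.05) / k * (1 + 72 / k) - 1) := by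
        field_simp
        ring
    _ ≤ 9.1 * l - μ / k * (68 / k) :=
        sub_le_sub_left (mul_le_mul_of_nonneg_left hbr (by positivity)) _
    _ = 9.1 * l - 68 * (μ / k ^ 2) := by field_simp
    _ ≤ -(57 * l) := by linarith

/-- The probability that the alternative is not detected in a late epoch `k`. -/
lemma HasLipschitzDensity.sampleLaw_not_exits_le {L : ℝ≥0} {P : Measure I} [IsProbabilityMeasure P]
    {f : I → ℝ} (h : HasLipschitzDensity L P f) {c₀ δ : ℝ} (hc : 28212 ≤ c₀)
    (hL : 2 * (L : ℝ) ≤ c₀) (hδ : 0 < δ) (hδ1 : δ < 1) {k : ℕ} (hk : 144 ≤ k)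
    (h0 : 0 < l1DistUniform f) (hγ : 288 ≤ l1DistUniform f ^ 2 * k) :
    (sampleLaw P).real {x | ¬ Exits c₀ δ x k} ≤ 1 / (k + 2 / δ) ^ 6 := by
  have hk1 : 1 ≤ k := by omega
  obtain ⟨hn2, hm⟩ := two_le_numSamples hc hδ hδ1 hk1
  obtain ⟨⟨hn, hn'⟩, hmA, hmA'⟩ := numSamples_numBins_bounds hc hδ hδ1 hk1
  have hl := one_le_log_add hδ hδ1 hk1
  have hk' : (144 : ℝ) ≤ k := by exact_mod_cast hk
  have hs := le_sqrt_of_le hc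
  obtain ⟨h1, h2, h3, h4, h5, h6⟩ :=
    sample_bin_estimates hs (by linarith) hl hn hn' hmA hmA'
  have hcu := expectedCoincidence_ge hm (n := numSamples c₀ δ k) (by omega)
  have : IsProbabilityMeasure (sampleLaw P) := by unfold sampleLaw; infer_instance
  have hthr : threshold c₀ δ k = 9 * (numSamples c₀ δ k : ℝ) *
    √(Real.log (k + 2 / δ) / (numBins c₀ δ k : ℝ)) := rfl
  rw [← hthr] at h6
  simp only [Exits, binnedCoincidence_eq hm, not_lt]
  generalize numSamples c₀ δ k = n at *
  generalize numBins c₀ δ k = m at *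
  generalize hldef : Real.log (k + 2 / δ) = l at *
  have hx : (0 : ℝ) < k + 2 / δ := by positivity
  have hn1 : (2 : ℝ) ≤ n := by exact_mod_cast hn2
  have hm1 : (0 : ℝ) < m := by exact_mod_cast hm
  set γ := l1DistUniform f with hγdef
  -- This uses `c₀ ≥ 2L`: `m ≥ 2 L k⁴ l`, while `γ k⁴ l ≥ γ k ≥ 1`.
  have hLm : (L : ℝ) / m ≤ γ / 2 := by
    have hγk : 1 ≤ γ * k := by nlinarith
    have hk4 : (k : ℝ) ≤ k ^ 4 := le_self_pow₀ (by linarith) (by norm_num)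
    have h7 : 1 ≤ γ * (k ^ 4 * l) := by
      have : (k : ℝ) ≤ k ^ 4 * l := by nlinarith
      nlinarith
    rw [div_le_iff₀ hm1]
    rw [Real.sq_sqrt (by linarith)] at hmA
    nlinarith [mul_le_mul_of_nonneg_left hmA h0.le]
  have hsum := h.le_sum_binProb_sq hm hLm h0.le
  rw [← hγdef] at hsum
  have hη : ∀ j, n * binProb P hm j ≤ 2.1 / k := by
    intro j
    calc (n : ℝ) * binProb P hm j ≤ n * (2 * √c₀ / m) := by
          gcongr
          exact h.binProb_le hm (h.le_two_mul_sqrt (by linarith) hL) j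
      _ = 2 * (n * √c₀ / m) := by ring
      _ ≤ 2 * (1.01 / k) := by gcongr
      _ = 2.02 / k := by ring
      _ ≤ _ := by gcongr; norm_num
  have hnn : 0 ≤ (n : ℝ) * (n - 1) := mul_nonneg (by linarith) (by linarith)
  set μ := (n : ℝ) * (n - 1) / m with hμ
  have hμ0 : 0 ≤ μ := div_nonneg hnn hm1.le
  refine le_trans (measureReal_mono ?_) ((sampleLaw_collisions_le P hm hn2 hη
    (μ + 9.1 * (k * l)) (t := 1 / k) (by positivity)).trans ?_)
  · intro x hx
    simp only [Set.mem_ofPred_eq] at hx ⊢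
    linarith
  · rw [← exp_neg_nat_mul_log hx, Real.exp_le_exp, hldef]
    have hq : μ * (1 + 72 / k) ≤ n * (n - 1) * ∑ j, binProb P hm j ^ 2 := by
      calc μ * (1 + 72 / k) ≤ μ * (1 + γ ^ 2 / 4) := by
            gcongr μ * (1 + ?_)
            rw [div_le_div_iff₀ (by linarith) (by norm_num)]
            linarith
        _ = n * (n - 1) * ((1 + γ ^ 2 / 4) / m) := by rw [hμ]; ring
        _ ≤ _ := by gcongr
    refine (lower_tail_exponent_le hk' h2 hq (by linarith)).trans ?_
    push_cast
    linarith

/-! ### The number of samples -/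

lemma numSamples_mono {c₀ δ : ℝ} (hδ : 0 < δ) : Monotone (numSamples c₀ δ) := by
  intro j k hjk
  refine Nat.ceil_mono ?_
  have hjk' : (j : ℝ) ≤ k := by exact_mod_cast hjk
  -- At `j = 0` the logarithm may be negative, since only `0 < δ` is assumed; there the factor `j³`
  -- vanishes.
  rcases Nat.eq_zero_or_pos j with rfl | hj
  · rcases Nat.eq_zero_or_pos k with rfl | hk
    · simp
    · have h1 : (1 : ℝ) ≤ k + 2 / δ := by
        have : (1 : ℝ) ≤ k := by exact_mod_cast hk
        have : 0 < 2 / δ := by positivity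
        linarith
      have := Real.log_nonneg h1
      simp only [CharP.cast_eq_zero, ne_eq, OfNat.ofNat_ne_zero, not_false_eq_true, zero_pow,
        mul_zero, zero_mul]
      positivity
  · have h1 : (1 : ℝ) ≤ j + 2 / δ := by
      have : (1 : ℝ) ≤ j := by exact_mod_cast hj
      have : 0 < 2 / δ := by positivity
      linarith
    have := Real.log_nonneg h1
    gcongr

lemma numSamples_le {c₀ δ : ℝ} (hc : 28212 ≤ c₀) (hδ : 0 < δ) (hδ1 : δ < 1) (k : ℕ) :
    (numSamples c₀ δ k : ℝ) ≤ 2 * √c₀ * (k ^ 3 * Real.log (k + 2 / δ)) := by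
  rcases Nat.eq_zero_or_pos k with rfl | hk
  · simp [numSamples]
  · have h := (numSamples_numBins_bounds hc hδ hδ1 hk).1.2
    have hs := le_sqrt_of_le hc
    have hk' : (1 : ℝ) ≤ k := by exact_mod_cast hk
    have h3 : 1 ≤ (k : ℝ) ^ 3 * Real.log (k + 2 / δ) :=
      one_le_mul_of_one_le_of_one_le (one_le_pow₀ hk') (one_le_log_add hδ hδ1 hk)
    nlinarith

/-- The existence of an epoch forces `g ≤ 24`, so `X = 1/g + 1/δ ≥ 25/24` and `log X` is bounded
away from 0. This absorbs the additive constant in `log (578 X²)`. -/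
lemma log_add_le {K g δ : ℝ} (hg : 0 < g) (hδ : 0 < δ) (hδ1 : δ < 1) (hK1 : 1 ≤ K)
    (hK : K ≤ 576 / g ^ 2) :
    Real.log (K + 2 / δ) ≤
      (Real.log 578 / Real.log (25 / 24) + 2) * Real.log (1 / g + 1 / δ) := by
  have hg2 : g ≤ 24 := by
    have h1 : 1 ≤ 576 / g ^ 2 := hK1.trans hK
    rw [le_div_iff₀ (by positivity)] at h1
    nlinarith
  have hgi : 1 / 24 ≤ 1 / g := by gcongr
  have hδi : 1 ≤ 1 / δ := by rw [le_div_iff₀ hδ]; linarith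
  set X := 1 / g + 1 / δ with hX
  have hX1 : 25 / 24 ≤ X := by linarith
  have hKX : K + 2 / δ ≤ 578 * X ^ 2 := by
    have h1 : K ≤ 576 * (1 / g) ^ 2 := hK.trans (le_of_eq (by ring))
    have h2 : (1 / g) ^ 2 ≤ X ^ 2 := pow_le_pow_left₀ (by positivity) (by linarith) 2
    have h3 : 2 / δ = 2 * (1 / δ) := by ring
    nlinarith
  have hpos : 0 < Real.log (25 / 24) := Real.log_pos (by norm_num)
  calc Real.log (K + 2 / δ) ≤ Real.log (578 * X ^ 2) := Real.log_le_log (by positivity) hKX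
    _ = Real.log 578 + 2 * Real.log X := by
        rw [Real.log_mul (by norm_num) (by positivity), Real.log_pow]
        norm_num
    _ = Real.log 578 / Real.log (25 / 24) * Real.log (25 / 24) + 2 * Real.log X := by
        rw [div_mul_cancel₀ _ hpos.ne']
    _ ≤ Real.log 578 / Real.log (25 / 24) * Real.log X + 2 * Real.log X := by
        have : 0 ≤ Real.log 578 := Real.log_nonneg (by norm_num)
        gcongr
    _ = _ := by ring

lemma numSamples_lastEpoch_le {c₀ δ g : ℝ} (hc : 28212 ≤ c₀) (hδ : 0 < δ) (hδ1 : δ < 1)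
    (hg : 0 < g) :
    (numSamples c₀ δ (lastEpoch g) : ℝ) ≤
      2 * 576 ^ 3 * (Real.log 578 / Real.log (25 / 24) + 2) * √c₀ *
        (1 / g ^ 6 * Real.log (1 / g + 1 / δ)) := by
  have hδi : 1 ≤ 1 / δ := by rw [le_div_iff₀ hδ]; linarith
  have hX : 0 ≤ Real.log (1 / g + 1 / δ) := Real.log_nonneg (by
    have : 0 < 1 / g := by positivity
    linarith)
  have hC : 0 ≤ Real.log 578 / Real.log (25 / 24) + 2 :=
    add_nonneg (div_nonneg (Real.log_nonneg (by norm_num)) (Real.log_nonneg (by norm_num)))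
      (by norm_num)
  refine (numSamples_le hc hδ hδ1 _).trans ?_
  have hK : (lastEpoch g : ℝ) ≤ 576 / g ^ 2 := Nat.floor_le (by positivity)
  generalize lastEpoch g = K at *
  rcases Nat.eq_zero_or_pos K with rfl | hK0
  · simp only [CharP.cast_eq_zero, ne_eq, OfNat.ofNat_ne_zero, not_false_eq_true, zero_pow,
        mul_zero, zero_mul]
    positivity
  · have hK1 : (1 : ℝ) ≤ K := by exact_mod_cast hK0
    have h1 := log_add_le hg hδ hδ1 hK1 hK
    have h2 : (K : ℝ) ^ 3 ≤ 576 ^ 3 / g ^ 6 :=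
      (pow_le_pow_left₀ (by positivity) hK 3).trans (le_of_eq (by rw [div_pow]; ring))
    have h3 : 0 ≤ Real.log ((K : ℝ) + 2 / δ) :=
      zero_le_one.trans (one_le_log_add hδ hδ1 hK0)
    calc 2 * √c₀ * ((K : ℝ) ^ 3 * Real.log (K + 2 / δ))
        ≤ 2 * √c₀ * (576 ^ 3 / g ^ 6 *
          ((Real.log 578 / Real.log (25 / 24) + 2) * Real.log (1 / g + 1 / δ))) := by gcongr
      _ = _ := by ring

/-- Telescoping: each term is at most `1/(k - 1 + x) - 1/(k + x)`. -/
lemma sum_one_div_add_sq_le {x : ℝ} (hx : 0 < x) (K : ℕ) :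
    ∑ k ∈ Finset.Icc 1 K, 1 / ((k : ℝ) + x) ^ 2 ≤ 1 / x - 1 / (K + x) := by
  induction K with
  | zero => simp
  | succ K ih =>
    rw [Finset.sum_Icc_succ_top (by omega)]
    have h : 1 / (((K + 1 : ℕ) : ℝ) + x) ^ 2 ≤ 1 / (K + x) - 1 / ((K + 1 : ℕ) + x) := by
      rw [div_sub_div _ _ (by positivity) (by positivity),
        div_le_div_iff₀ (by positivity) (by positivity)]
      push_cast
      have : 0 ≤ (K : ℝ) := Nat.cast_nonneg K
      nlinarith
    linarith

lemma sum_one_div_add_sq_le_half {δ : ℝ} (hδ : 0 < δ) (K : ℕ) :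
    ∑ k ∈ Finset.Icc 1 K, 1 / ((k : ℝ) + 2 / δ) ^ 2 ≤ δ / 2 := by
  have h := sum_one_div_add_sq_le (x := 2 / δ) (by positivity) K
  have h2 : 0 ≤ 1 / ((K : ℝ) + 2 / δ) := by positivity
  rw [one_div_div] at h
  linarith

/-! ### The stopping epoch -/

lemma stoppingEpoch_le (c₀ ε δ : ℝ) (x : ℕ → I) : stoppingEpoch c₀ ε δ x ≤ lastEpoch ε := by
  classical
  unfold stoppingEpoch
  split_ifs with h
  · exact (Nat.find_spec h).2.1
  · exact le_rfl

lemma not_exits_of_lt_stoppingEpoch {c₀ ε δ : ℝ} {x : ℕ → I} {k : ℕ} (hk : 1 ≤ k)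
    (h : k < stoppingEpoch c₀ ε δ x) : ¬ Exits c₀ δ x k := by
  classical
  intro he
  have hK := h.le.trans (stoppingEpoch_le c₀ ε δ x)
  have hS : ExitsSomewhere c₀ ε δ x := ⟨k, hk, hK, he⟩
  rw [stoppingEpoch, dif_pos hS] at h
  exact Nat.find_min hS h ⟨hk, hK, he⟩

lemma output_eq_H1_iff {c₀ ε δ : ℝ} {x : ℕ → I} :
    output c₀ ε δ x = Hypothesis.H1 ↔ ExitsSomewhere c₀ ε δ x := by
  unfold output
  split_ifs with h <;> simp [h]

lemma output_eq_H0_iff {c₀ ε δ : ℝ} {x : ℕ → I} :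
    output c₀ ε δ x = Hypothesis.H0 ↔ ¬ ExitsSomewhere c₀ ε δ x := by
  unfold output
  split_ifs with h <;> simp [h]

lemma measurable_binnedCoincidence (n m : ℕ) : Measurable (binnedCoincidence n m) :=
  (Measurable.of_discrete (f := fun s : Fin n → ℕ => coincidence m s)).comp
    (measurable_pi_lambda _ fun _ => (measurable_binLabel m).comp (measurable_pi_apply _))

lemma measurableSet_exits (c₀ δ : ℝ) (k : ℕ) : MeasurableSet {x : ℕ → I | Exits c₀ δ x k} :=
  measurableSet_lt measurable_const (measurable_const.sub
    (Measurable.of_discrete.comp (measurable_binnedCoincidence _ _)))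

instance (P : Measure I) [IsProbabilityMeasure P] : IsProbabilityMeasure (sampleLaw P) := by
  unfold sampleLaw; infer_instance

/-- The sample complexity, through the probabilities of the epochs without an exit. -/
lemma expectedSamples_le {c₀ ε δ : ℝ} (hδ : 0 < δ) (P : Measure I) [IsProbabilityMeasure P]
    {k₀ : ℕ} (hk₀ : 1 ≤ k₀) {r : ℕ → ℝ} (hr0 : ∀ k, 0 ≤ r k)
    (hr : ∀ k, k₀ ≤ k → (sampleLaw P).real {x | ¬ Exits c₀ δ x k} ≤ r k) :
    expectedSamples c₀ ε δ P ≤ ENNReal.ofReal (numSamples c₀ δ k₀ +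
      ∑ k ∈ Finset.Ico k₀ (lastEpoch ε), (numSamples c₀ δ (k + 1) : ℝ) * r k) := by
  have hpt : ∀ x : ℕ → I, (samplesUsed c₀ ε δ x : ℝ≥0∞) ≤ numSamples c₀ δ k₀ +
      ∑ k ∈ Finset.Ico k₀ (lastEpoch ε),
        {x | ¬ Exits c₀ δ x k}.indicator (fun _ => (numSamples c₀ δ (k + 1) : ℝ≥0∞)) x := by
    intro x
    rcases le_or_gt (stoppingEpoch c₀ ε δ x) k₀ with h | h
    · refine le_add_right ?_
      exact_mod_cast numSamples_mono hδ h
    · refine le_add_left ?_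
      -- Stopping in epoch `k + 1 > k₀` means that epoch `k` had no exit, so the `k`-th summand
      -- alone pays for all samples.
      obtain ⟨k, hk⟩ : ∃ k, stoppingEpoch c₀ ε δ x = k + 1 := ⟨_, (Nat.succ_pred (by omega)).symm⟩
      have hK := stoppingEpoch_le c₀ ε δ x
      have hmem : k ∈ Finset.Ico k₀ (lastEpoch ε) := by
        rw [Finset.mem_Ico]; omega
      refine le_trans ?_ (Finset.single_le_sum (f := fun k =>
        {x | ¬ Exits c₀ δ x k}.indicator (fun _ => (numSamples c₀ δ (k + 1) : ℝ≥0∞)) x)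
        (fun _ _ => zero_le) hmem)
      have hx : x ∈ {x | ¬ Exits c₀ δ x k} :=
        not_exits_of_lt_stoppingEpoch (ε := ε) (by omega) (by omega)
      simp only [Set.indicator_of_mem hx, samplesUsed, hk, le_refl]
  calc expectedSamples c₀ ε δ P
      ≤ ∫⁻ x, (numSamples c₀ δ k₀ + ∑ k ∈ Finset.Ico k₀ (lastEpoch ε),
        {x | ¬ Exits c₀ δ x k}.indicator
          (fun _ => (numSamples c₀ δ (k + 1) : ℝ≥0∞)) x) ∂(sampleLaw P) := lintegral_mono hpt
    _ = numSamples c₀ δ k₀ + ∑ k ∈ Finset.Ico k₀ (lastEpoch ε),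
        numSamples c₀ δ (k + 1) * (sampleLaw P) {x | ¬ Exits c₀ δ x k} := by
        rw [lintegral_add_left measurable_const, lintegral_const, measure_univ, mul_one,
          lintegral_finsetSum]
        · congr 1
          exact Finset.sum_congr rfl fun k _ =>
            lintegral_indicator_const (measurableSet_exits c₀ δ k).compl _
        · exact fun k _ => measurable_const.indicator (measurableSet_exits c₀ δ k).compl
    _ ≤ numSamples c₀ δ k₀ + ∑ k ∈ Finset.Ico k₀ (lastEpoch ε),
        ENNReal.ofReal (numSamples c₀ δ (k + 1) * r k) := by
        gcongr with k hk
        rw [ENNReal.ofReal_mul (Nat.cast_nonneg _), ENNReal.ofReal_natCast]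
        gcongr
        rw [← ofReal_measureReal]
        exact ENNReal.ofReal_le_ofReal (hr k (Finset.mem_Ico.1 hk).1)
    _ = _ := by
        rw [ENNReal.ofReal_add (Nat.cast_nonneg _)
          (Finset.sum_nonneg fun k _ => mul_nonneg (Nat.cast_nonneg _) (hr0 k)),
          ENNReal.ofReal_natCast, ENNReal.ofReal_sum_of_nonneg
          fun k _ => mul_nonneg (Nat.cast_nonneg _) (hr0 k)]

/-- Since `n_{k+1} ≤ 2 √c₀ (k + 2/δ)⁴`, the sixth power leaves a summable square. -/
lemma sum_numSamples_mul_le {c₀ δ : ℝ} (hc : 28212 ≤ c₀) (hδ : 0 < δ) (hδ1 : δ < 1) {k₀ : ℕ}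
    (hk₀ : 1 ≤ k₀) (K : ℕ) :
    ∑ k ∈ Finset.Ico k₀ K, (numSamples c₀ δ (k + 1) : ℝ) * (1 / ((k : ℝ) + 2 / δ) ^ 6) ≤ √c₀ := by
  have h2 : 2 ≤ 2 / δ := by rw [le_div_iff₀ hδ]; linarith
  have hterm : ∀ k : ℕ, (numSamples c₀ δ (k + 1) : ℝ) * (1 / ((k : ℝ) + 2 / δ) ^ 6) ≤
      2 * √c₀ * (1 / ((k : ℝ) + 2 / δ) ^ 2) := by
    intro k
    have h := numSamples_le hc hδ hδ1 (k + 1)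
    have hy : 0 < (k : ℝ) + 2 / δ := by positivity
    have hlog : Real.log (((k + 1 : ℕ) : ℝ) + 2 / δ) ≤ k + 2 / δ :=
      (Real.log_le_sub_one_of_pos (by positivity)).trans (by push_cast; linarith)
    have hlog0 : 0 ≤ Real.log (((k + 1 : ℕ) : ℝ) + 2 / δ) := Real.log_nonneg (by
      push_cast
      linarith)
    have hk : ((k + 1 : ℕ) : ℝ) ≤ k + 2 / δ := by push_cast; linarith
    calc (numSamples c₀ δ (k + 1) : ℝ) * (1 / ((k : ℝ) + 2 / δ) ^ 6)
        ≤ 2 * √c₀ * (((k : ℝ) + 2 / δ) ^ 3 * (k + 2 / δ)) * (1 / ((k : ℝ) + 2 / δ) ^ 6) := by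
          refine mul_le_mul_of_nonneg_right (h.trans ?_) (by positivity)
          gcongr
      _ = _ := by field_simp
  calc ∑ k ∈ Finset.Ico k₀ K, (numSamples c₀ δ (k + 1) : ℝ) * (1 / ((k : ℝ) + 2 / δ) ^ 6)
      ≤ ∑ k ∈ Finset.Icc 1 K, 2 * √c₀ * (1 / ((k : ℝ) + 2 / δ) ^ 2) := by
        refine (Finset.sum_le_sum fun k _ => hterm k).trans
          (Finset.sum_le_sum_of_subset_of_nonneg (fun k hk => ?_) fun k _ _ => by positivity)
        rw [Finset.mem_Ico] at hk
        rw [Finset.mem_Icc]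
        omega
    _ = 2 * √c₀ * ∑ k ∈ Finset.Icc 1 K, 1 / ((k : ℝ) + 2 / δ) ^ 2 := by rw [Finset.mul_sum]
    _ ≤ 2 * √c₀ * (δ / 2) := by
        gcongr
        exact sum_one_div_add_sq_le_half hδ K
    _ ≤ √c₀ := by nlinarith [Real.sqrt_nonneg c₀]

lemma one_sub_measureReal_compl_le {Ω : Type*} [MeasurableSpace Ω] (μ : Measure Ω)
    [IsProbabilityMeasure μ] (A : Set Ω) : 1 - μ.real Aᶜ ≤ μ.real A := by
  have h := measureReal_union_le (μ := μ) A Aᶜ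
  rw [Set.union_compl_self, probReal_univ] at h
  linarith

/-! ### The two hypotheses -/

lemma outputProb_H0_ge {c₀ ε δ : ℝ} (hc : 28212 ≤ c₀) (hδ : 0 < δ) (hδ1 : δ < 1) :
    1 - δ ≤ outputProb c₀ ε δ (volume : Measure I) Hypothesis.H0 := by
  refine le_trans ?_ (one_sub_measureReal_compl_le _ _)
  have hsub : {x | output c₀ ε δ x = Hypothesis.H0}ᶜ ⊆
      ⋃ k ∈ Finset.Icc 1 (lastEpoch ε), {x | Exits c₀ δ x k} := by
    intro x hx
    rw [Set.mem_compl_iff, Set.mem_ofPred_eq, output_eq_H0_iff, not_not] at hx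
    obtain ⟨k, h1, h2, h3⟩ := hx
    exact Set.mem_biUnion (Finset.mem_Icc.2 ⟨h1, h2⟩) h3
  have h : (sampleLaw (volume : Measure I)).real {x | output c₀ ε δ x = Hypothesis.H0}ᶜ ≤ δ / 2 :=
    calc _ ≤ _ := measureReal_mono hsub (measure_ne_top _ _)
      _ ≤ ∑ k ∈ Finset.Icc 1 (lastEpoch ε),
          (sampleLaw (volume : Measure I)).real {x | Exits c₀ δ x k} :=
        measureReal_biUnion_finset_le _ _
      _ ≤ ∑ k ∈ Finset.Icc 1 (lastEpoch ε), 1 / ((k : ℝ) + 2 / δ) ^ 2 :=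
        Finset.sum_le_sum fun k hk =>
          sampleLaw_volume_exits_le hc hδ hδ1 (Finset.mem_Icc.1 hk).1
      _ ≤ δ / 2 := sum_one_div_add_sq_le_half hδ _
  linarith

lemma expectedSamples_le_numSamples_lastEpoch {c₀ ε δ : ℝ} (hδ : 0 < δ) (P : Measure I)
    [IsProbabilityMeasure P] :
    expectedSamples c₀ ε δ P ≤ ENNReal.ofReal (numSamples c₀ δ (lastEpoch ε)) := by
  rw [ENNReal.ofReal_natCast]
  calc expectedSamples c₀ ε δ P
      ≤ ∫⁻ _, (numSamples c₀ δ (lastEpoch ε) : ℝ≥0∞) ∂(sampleLaw P) := by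
        refine lintegral_mono fun x => ?_
        exact Nat.cast_le.2 (numSamples_mono hδ (stoppingEpoch_le c₀ ε δ x))
    _ = _ := by rw [lintegral_const, measure_univ, mul_one]

lemma le_lastEpoch {g : ℝ} (hg : 0 < g) (hg2 : g ≤ 2) : 144 ≤ lastEpoch g := by
  refine Nat.le_floor ?_
  push_cast
  rw [le_div_iff₀ (by positivity)]
  nlinarith

lemma HasLipschitzDensity.sampleLaw_not_exits_le_of_lastEpoch_le {L : ℝ≥0} {P : Measure I}
    [IsProbabilityMeasure P] {f : I → ℝ} (h : HasLipschitzDensity L P f) {c₀ δ : ℝ}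
    (hc : 28212 ≤ c₀) (hL : 2 * (L : ℝ) ≤ c₀) (hδ : 0 < δ) (hδ1 : δ < 1)
    (h0 : 0 < l1DistUniform f) {k : ℕ} (hk : lastEpoch (l1DistUniform f) ≤ k) :
    (sampleLaw P).real {x | ¬ Exits c₀ δ x k} ≤ 1 / (k + 2 / δ) ^ 6 := by
  have h1 := (le_lastEpoch h0 h.l1DistUniform_le_two).trans hk
  refine h.sampleLaw_not_exits_le hc hL hδ hδ1 h1 h0 ?_
  -- The floor only gives `k + 1 > 576/γ²`. As `k + 1 ≤ 2k`, half of 576 remains, which is the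
  -- required 288.
  have h2 : 576 / l1DistUniform f ^ 2 < (k : ℝ) + 1 := by
    have := Nat.lt_succ_of_le hk
    rw [lastEpoch, Nat.floor_lt (by positivity)] at this
    exact_mod_cast this
  rw [div_lt_iff₀ (by positivity)] at h2
  have h3 : (1 : ℝ) ≤ k := by exact_mod_cast (by omega : 1 ≤ k)
  nlinarith [sq_nonneg (l1DistUniform f)]

lemma HasLipschitzDensity.outputProb_H1_ge {L : ℝ≥0} {P : Measure I} [IsProbabilityMeasure P]
    {f : I → ℝ} (h : HasLipschitzDensity L P f) {c₀ ε δ : ℝ} (hc : 28212 ≤ c₀)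
    (hL : 2 * (L : ℝ) ≤ c₀) (hε : 0 < ε) (hδ : 0 < δ) (hδ1 : δ < 1)
    (hεf : ε ≤ l1DistUniform f) :
    1 - δ ≤ outputProb c₀ ε δ P Hypothesis.H1 := by
  have h0 := hε.trans_le hεf
  refine le_trans ?_ (one_sub_measureReal_compl_le _ _)
  have hK : lastEpoch (l1DistUniform f) ≤ lastEpoch ε := by
    unfold lastEpoch
    gcongr
  have hK1 : 1 ≤ lastEpoch ε :=
    le_trans (by norm_num) ((le_lastEpoch h0 h.l1DistUniform_le_two).trans hK)
  -- An output other than `H1` requires in particular that the last epoch does not exit, and that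
  -- epoch alone is reliable enough.
  have hsub : {x | output c₀ ε δ x = Hypothesis.H1}ᶜ ⊆ {x | ¬ Exits c₀ δ x (lastEpoch ε)} := by
    intro x hx
    rw [Set.mem_compl_iff, Set.mem_ofPred_eq, output_eq_H1_iff] at hx
    exact fun he => hx ⟨_, hK1, le_rfl, he⟩
  have h1 := (measureReal_mono (μ := sampleLaw P) hsub (measure_ne_top _ _)).trans
    (h.sampleLaw_not_exits_le_of_lastEpoch_le hc hL hδ hδ1 h0 hK)
  have h2 : 1 / ((lastEpoch ε : ℝ) + 2 / δ) ^ 6 ≤ δ := by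
    have hy : 1 / δ ≤ (lastEpoch ε : ℝ) + 2 / δ := by
      have : 2 / δ = 1 / δ + 1 / δ := by ring
      have : 0 < 1 / δ := by positivity
      have : (0 : ℝ) ≤ lastEpoch ε := Nat.cast_nonneg _
      linarith
    have hδi : 1 ≤ 1 / δ := by rw [le_div_iff₀ hδ]; linarith
    rw [div_le_iff₀ (by positivity), ← div_le_iff₀' hδ]
    exact hy.trans (le_self_pow₀ (hδi.trans hy) (by norm_num))
  linarith

lemma HasLipschitzDensity.expectedSamples_le {L : ℝ≥0} {P : Measure I} [IsProbabilityMeasure P]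
    {f : I → ℝ} (h : HasLipschitzDensity L P f) {c₀ ε δ : ℝ} (hc : 28212 ≤ c₀)
    (hL : 2 * (L : ℝ) ≤ c₀) (hδ : 0 < δ) (hδ1 : δ < 1) (h0 : 0 < l1DistUniform f) :
    expectedSamples c₀ ε δ P ≤
      ENNReal.ofReal ((2 * 576 ^ 3 * (Real.log 578 / Real.log (25 / 24) + 2) +
        64 / Real.log (3 / 2)) * √c₀ * (1 / l1DistUniform f ^ 6 *
          Real.log (1 / l1DistUniform f + 1 / δ))) := by
  have h2 := h.l1DistUniform_le_two
  have hk0 := le_lastEpoch h0 h2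
  refine (ABC.expectedSamples_le hδ P (le_trans (by norm_num) hk0) (fun k => by positivity)
    fun k hk => h.sampleLaw_not_exits_le_of_lastEpoch_le hc hL hδ hδ1 h0 hk).trans
    (ENNReal.ofReal_le_ofReal ?_)
  have h3 := numSamples_lastEpoch_le hc hδ hδ1 h0
  have h4 := sum_numSamples_mul_le hc hδ hδ1 (le_trans (by norm_num) hk0) (lastEpoch ε)
  set γ := l1DistUniform f
  have hlog : 0 < Real.log (3 / 2) := Real.log_pos (by norm_num)
  have hX : Real.log (3 / 2) ≤ Real.log (1 / γ + 1 / δ) := by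
    apply Real.log_le_log (by norm_num)
    have h5 : 1 / 2 ≤ 1 / γ := by gcongr
    have h6 : 1 ≤ 1 / δ := by rw [le_div_iff₀ hδ]; linarith
    linarith
  have h7 : 1 / 64 ≤ 1 / γ ^ 6 := by
    gcongr
    calc γ ^ 6 ≤ 2 ^ 6 := by gcongr
      _ = 64 := by norm_num
  -- Because `γ ≤ 2` and `δ < 1`, the target rate is at least `log (3/2) / 64`, so it absorbs the
  -- tail `√c₀`.
  have h8 : √c₀ ≤ 64 / Real.log (3 / 2) * √c₀ * (1 / γ ^ 6 * Real.log (1 / γ + 1 / δ)) := by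
    calc √c₀ = 64 / Real.log (3 / 2) * √c₀ * (1 / 64 * Real.log (3 / 2)) := by field_simp
      _ ≤ _ := by gcongr
  rw [add_mul, add_mul]
  linarith

end ABC

theorem theorem2 :
    ∃ C : ℝ, 0 < C ∧
      ∀ (L : ℝ≥0) (c₀ ε δ : ℝ), 28212 ≤ c₀ → 2 * (L : ℝ) ≤ c₀ → 0 < ε → 0 < δ → δ < 1 →
        -- the alternative hypothesis
        (∀ (P : Measure I) [IsProbabilityMeasure P] (f : I → ℝ) (γ : ℝ),
          ABC.HasLipschitzDensity L P f → ABC.l1DistUniform f = γ → ε ≤ γ →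
            ABC.expectedSamples c₀ ε δ P ≤
              ENNReal.ofReal (C * Real.sqrt c₀ * (1 / γ ^ 6 * Real.log (1 / γ + 1 / δ))) ∧
            1 - δ ≤ ABC.outputProb c₀ ε δ P ABC.Hypothesis.H1) ∧
        -- the null hypothesis
        (ABC.expectedSamples c₀ ε δ (volume : Measure I) ≤
            ENNReal.ofReal (C * Real.sqrt c₀ * (1 / ε ^ 6 * Real.log (1 / ε + 1 / δ))) ∧
          1 - δ ≤ ABC.outputProb c₀ ε δ (volume : Measure I) ABC.Hypothesis.H0)
 := by
  set C₁ := 2 * 576 ^ 3 * (Real.log 578 / Real.log (25 / 24) + 2) with hC₁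
  set C₂ := 64 / Real.log (3 / 2) with hC₂
  have h1 : 0 < C₁ := by
    have : 0 < Real.log 578 / Real.log (25 / 24) :=
      div_pos (Real.log_pos (by norm_num)) (Real.log_pos (by norm_num))
    positivity
  have h2 : 0 < C₂ := div_pos (by norm_num) (Real.log_pos (by norm_num))
  -- `C₁` pays for all samples up to the critical epoch, `C₂` for the later epochs under the
  -- alternative.
  refine ⟨C₁ + C₂, by positivity, ?_⟩
  intro L c₀ ε δ hc hL hε hδ hδ1
  refine ⟨?_, ?_, ABC.outputProb_H0_ge hc hδ hδ1⟩
  · rintro P _ f γ h rfl hγ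
    exact ⟨h.expectedSamples_le hc hL hδ hδ1 (hε.trans_le hγ),
      h.outputProb_H1_ge hc hL hε hδ hδ1 hγ⟩
  · refine (ABC.expectedSamples_le_numSamples_lastEpoch hδ volume).trans
      (ENNReal.ofReal_le_ofReal ?_)
    refine (ABC.numSamples_lastEpoch_le hc hδ hδ1 hε).trans ?_
    have hδi : 1 ≤ 1 / δ := by rw [le_div_iff₀ hδ]; linarith
    have hX : 0 ≤ Real.log (1 / ε + 1 / δ) := Real.log_nonneg (by
      have : 0 < 1 / ε := by positivity
      linarith)
    gcongr
    linarith
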